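/- **Setting (linear Bargmann–Fock model).** Let $V\cong\mathbb C^m$ be a finite-dimensional complex vector space with a Hermitian inner product, $\omega=i\sum_j dz_j\wedge d\bar z_j=2\sum_j dx_j\wedge dy_j$ in unitary coordinates, $d\mathrm{Vol}=\omega^m/m!$. For $k\in\mathbb N$ the Bergman kernel of the Bargmann–Fock space of degree $k$, written in the unitary frame, is $$\Pi_k(z,w)=\Big(\frac{k}{2\pi}\Big)^{m}e^{k(z\cdot\bar w-|z|^2/2-|w|^2/2)}.$$ Let $H:V\to\mathbb R$ be a real homogeneous quadratic form, $\xi_H$ its Hamilton vector field ($dH=\iota_{\xi_H}\omega$), and $g^t=\exp(t\xi_H)$ its linear Hamilton flow; write $g^t v=P_t v+Q_t\bar v$, so that the complex-linear map $P_t=\tfrac12(g^t-i\,g^t i)$ is the holomorphic block of $Dg^t=g^t$. It is invertible for every $t$; let $(\det P_t)^{1/2}$ denote the branch which is continuous in $t\in\mathbb R$ and equal to $1$ at $t=0$. On the circle bundle $V\times S^1$ with contact form $d\theta+\mathrm{Im}(\bar z\cdot dz)$ let $\theta_{z,t}=-\int_0^t\mathrm{Im}\big(\overline{g^sz}\cdot\xi_H(g^sz)\big)ds$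 be the holonomy angle of the horizontal lift of $s\mapsto g^sz$, $0\le s\le t$, and let $\hat g^t(z,\theta)=(g^tz,\theta+\theta_{z,t}-tH(z))$ be the contact lift of the flow. The propagator $U_k(t)=\eta_t\,\hat\Pi_k(\hat g^{-t})^*\hat\Pi_k$, $\eta_t=(\det P_t^*)^{1/2}=\overline{(\det P_t)^{1/2}}$, is the metaplectic quantization of $g^t$ on the Bargmann–Fock space of degree $k$; the metric contraction of its kernel at $z$ is $$U_k(t,z)=\eta_t\int_V\Pi_k(z,g^tu)\,e^{-ik(\theta_{u,t}-tH(u))}\,\Pi_k(u,z)\,d\mathrm{Vol}(u).$$ **Statement.** Assume that all level sets of $H$ are compact and that the periodic orbits on the level $\{H=E\}$ are nondegenerate, i.e. for each periodic point $w$ with $H(w)=E$ and minimal period $T_w>0$ the eigenvalue $1$ of $Dg^{T_w}$ has algebraic multiplicity two. Let $z$ be a periodic point with $H(z)=E$ which has a minimal period $T_z>0$, and let $f\in\mathcal S(\mathbb R)$ be such that $\hat f(t)=\frac1{2\pi}\int f(x)e^{-itx}dx$ has compact support. Put $P_n=P_{nT_z}$ and let $\alpha\in V$ be the $(1,0)$-component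 of $\xi_H(z)$, that is, $\xi_H(z)=\sum_j(\alpha_j\partial_{z_j}+\bar\alpha_j\partial_{\bar z_j})$. Then, as $k\to\infty$ through the natural numbers, $$\int_{\mathbb R}\hat f(t)\,U_k(t,z)\,e^{-itEk}\,dt=\Big(\frac{k}{2\pi}\Big)^{m-\frac12}\sum_{n\in\mathbb Z}\hat f(nT_z)\,e^{-ik\theta_{z,nT_z}}\,(\bar\alpha\cdot P_n^{-1}\alpha)^{-1/2}(\det P_n)^{-1/2}+O\big(k^{m-3/2}\big),$$ where $(\bar\alpha\cdot P_n^{-1}\alpha)^{-1/2}$ is the principal branch and $(\det P_n)^{-1/2}$ is the inverse of the continuous branch $(\det P_t)^{1/2}$ at $t=nT_z$. -/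

import Mathlib

open MeasureTheory Filter Asymptotics
open scoped Real SchwartzMap

namespace BargmannFock

noncomputable section

/-!
The linear model is a finite-dimensional complex inner product space `V`, that is, `ℂ^m` with a
linear complex structure `J = i` and a Hermitian metric; `m = Module.finrank ℂ V`.  For `V = ℂ^m`
with its standard structure, `inner ℂ w z` is `z · w̄ = ∑ j, z_j * conj w_j`.  The Kähler potential
is `‖z‖ ^ 2`.
-/

/-! ### Classical side: symplectic form, Hamilton flow, horizontal and contact lifts -/

/-- The Kähler form `ω = i ∑ dz_j ∧ dz̄_j = 2 ∑ dx_j ∧ dy_j`. -/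
def omega {V : Type*} [NormedAddCommGroup V] [InnerProductSpace ℂ V] (v w : V) : ℝ :=
  2 * (inner ℂ v w).im

/-- The Hamilton vector field `ξ_H` of a quadratic Hamiltonian, as a real-linear vector field:
in unitary coordinates its `∂_{z_j}`-component is `-i ∂H/∂z̄_j`.  It is characterised by
`dH = ι_ξ ω`, see `omega_hamField` (`dH` at `z` is `QuadraticMap.polar H z`). -/
def hamField {V : Type*} [NormedAddCommGroup V] [InnerProductSpace ℂ V] [FiniteDimensional ℂ V]
    (H : QuadraticForm ℝ V) : V →L[ℝ] V :=
  ∑ j, (LinearMap.toContinuousLinearMap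
    (((QuadraticMap.polarBilin H).flip (stdOrthonormalBasis ℂ V j)).smulRight
        ((-Complex.I / 2) • stdOrthonormalBasis ℂ V j)
      + ((QuadraticMap.polarBilin H).flip (Complex.I • stdOrthonormalBasis ℂ V j)).smulRight
        ((-Complex.I / 2) • Complex.I • stdOrthonormalBasis ℂ V j)))

/-- The Hamilton flow `g^t = exp (t ξ_H)`, a group of real-linear maps. -/
def hamFlow {V : Type*} [NormedAddCommGroup V] [InnerProductSpace ℂ V] [FiniteDimensional ℂ V]
    (H : QuadraticForm ℝ V) (t : ℝ) : V →L[ℝ] V :=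
  NormedSpace.exp (t • hamField H)

/-- `T` is the minimal period `T_z` of `z`. -/
def IsMinimalPeriod {V : Type*} [NormedAddCommGroup V] [InnerProductSpace ℂ V]
    [FiniteDimensional ℂ V] (H : QuadraticForm ℝ V) (z : V) (T : ℝ) : Prop :=
  IsLeast {t : ℝ | 0 < t ∧ hamFlow H t z = z} T

/-- The periodic orbits on the level `{H = E}` are nondegenerate: for every periodic point `w` of
that level, with minimal period `T`, the eigenvalue `1` of `D g^T = g^T` has algebraic multiplicity
exactly two (equivalently, `1` is not an eigenvalue of the linearised Poincaré map). -/
def NondegenerateOrbits {V : Type*} [NormedAddCommGroup V] [InnerProductSpace ℂ V]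
    [FiniteDimensional ℂ V] (H : QuadraticForm ℝ V) (E : ℝ) : Prop :=
  ∀ (w : V) (T : ℝ), H w = E → IsMinimalPeriod H w T →
    Module.finrank ℝ
      (Module.End.maxGenEigenspace (hamFlow H T : V →ₗ[ℝ] V) 1) = 2

/-- The holonomy angle `θ_{z,t}`: the contact form on the circle bundle `V × S¹` is
`α = dθ + (i/2) ∑ (z_j dz̄_j - z̄_j dz_j) = dθ + Im (z̄ · dz)`, and the horizontal lift of the orbit
`s ↦ g^s z` through `(z, 0)` is at `(g^t z, θ_{z,t})` at time `t`. -/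
def holonomyAngle {V : Type*} [NormedAddCommGroup V] [InnerProductSpace ℂ V]
    [FiniteDimensional ℂ V] (H : QuadraticForm ℝ V) (z : V) (t : ℝ) : ℝ :=
  -∫ s in (0 : ℝ)..t, (inner ℂ (hamFlow H s z) (hamField H (hamFlow H s z))).im

/-- The contact lift `ĝ^t (z, θ) = (g^t z, θ + contactAngle H z t)` of the Hamilton flow, generated
by `ξ_H^h - H ∂_θ`. -/
def contactAngle {V : Type*} [NormedAddCommGroup V] [InnerProductSpace ℂ V]
    [FiniteDimensional ℂ V] (H : QuadraticForm ℝ V) (z : V) (t : ℝ) : ℝ :=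
  holonomyAngle H z t - t * H z

/-! ### The holomorphic block -/

/-- The holomorphic block `P = π^{1,0} S π^{1,0}` of a real-linear map `S`, acting on
`T^{1,0} ≅ V`: writing `S v = P v + Q v̄`, it is the complex-linear part `(S - i S i) / 2`. -/
def holBlock {V : Type*} [NormedAddCommGroup V] [InnerProductSpace ℂ V]
    (S : V →L[ℝ] V) : V →ₗ[ℂ] V where
  toFun v := (1 / 2 : ℂ) • (S v - Complex.I • S (Complex.I • v))
  map_add' := by intro x y; simp only [map_add, smul_add]; module
  map_smul' := by
    intro c x
    have h : ∀ v : V, S (c • v) = c.re • S v + c.im • S (Complex.I • v) := by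
      intro v
      have : c • v = c.re • v + c.im • (Complex.I • v) := by
        conv_lhs => rw [← Complex.re_add_im c]
        rw [add_smul, mul_smul]; rfl
      rw [this, map_add, map_smul, map_smul]
    have h2 : S (Complex.I • (Complex.I • x)) = - S x := by
      rw [smul_smul, Complex.I_mul_I, neg_one_smul, map_neg]
    rw [smul_comm Complex.I c x, h, h, h2, RingHom.id_apply]
    have e : ∀ (r : ℝ) (v : V), r • v = (r : ℂ) • v := fun r v => rfl
    simp only [e]
    conv_rhs => rw [← Complex.re_add_im c]
    have hI : Complex.I ^ 2 = -1 := Complex.I_sq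
    match_scalars
    · linear_combination (-(c.im : ℂ) / 2 * 0) * hI
    · linear_combination ((c.im : ℂ) / 2) * hI

/-- The holomorphic block of `g^t` (so `P_n` is `flowBlock H (n * T_z)`). -/
def flowBlock {V : Type*} [NormedAddCommGroup V] [InnerProductSpace ℂ V] [FiniteDimensional ℂ V]
    (H : QuadraticForm ℝ V) (t : ℝ) : V →ₗ[ℂ] V :=
  holBlock (hamFlow H t)

/-- The branch of `(det P_t)^{1/2}` along the flow that is continuous in `t` and equals `1` at
`t = 0` (the lift of `g^t` to the metaplectic double cover), written as
`exp (½ ∫₀ᵗ d log det P_s)`. -/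
def detRoot {V : Type*} [NormedAddCommGroup V] [InnerProductSpace ℂ V] [FiniteDimensional ℂ V]
    (H : QuadraticForm ℝ V) (t : ℝ) : ℂ :=
  Complex.exp ((1 / 2 : ℂ) * ∫ s in (0 : ℝ)..t,
    deriv (fun r : ℝ => LinearMap.det (flowBlock H r)) s / LinearMap.det (flowBlock H s))

/-! ### Quantum side -/

/-- The Liouville volume `ω^m / m! = 2^m ∏ dx_j dy_j`, in unitary coordinates. -/
def liouville (V : Type*) [NormedAddCommGroup V] [InnerProductSpace ℂ V]
    [FiniteDimensional ℂ V] [MeasurableSpace V] : Measure V :=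
  (2 : ENNReal) ^ Module.finrank ℂ V •
    (volume : Measure (Fin (Module.finrank ℂ V) → ℂ)).map
      (fun c => ∑ j, c j • stdOrthonormalBasis ℂ V j)

/-- The Bergman kernel of degree `k` of the Bargmann–Fock space in the unitary frame:
`(k / 2π)^m exp (k (z · w̄ - |z|² / 2 - |w|² / 2))`.  The kernel on the circle bundle is
`exp (i k (θ_z - θ_w))` times it. -/
def bergman {V : Type*} [NormedAddCommGroup V] [InnerProductSpace ℂ V]
    (k : ℕ) (z w : V) : ℂ :=
  ((k : ℂ) / (2 * π)) ^ Module.finrank ℂ V *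
    Complex.exp (k * (inner ℂ w z - (‖z‖ : ℂ) ^ 2 / 2 - (‖w‖ : ℂ) ^ 2 / 2))

/-- The kernel of the metaplectic propagator `U_k(t) = η_t Π̂_k (ĝ^{-t})^* Π̂_k` on the
Bargmann–Fock space of degree `k`, with `η_t = (det P_t^*)^{1/2}`, in the unitary frame:
`η_t ∫ Π̂_k (ẑ, ĝ^t û) Π̂_k (û, ŵ) dVol`. -/
def propagator {V : Type*} [NormedAddCommGroup V] [InnerProductSpace ℂ V]
    [FiniteDimensional ℂ V] [MeasurableSpace V]
    (H : QuadraticForm ℝ V) (k : ℕ) (t : ℝ) (z w : V) : ℂ :=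
  starRingEnd ℂ (detRoot H t) *
    ∫ u, bergman k z (hamFlow H t u) *
      Complex.exp (-(Complex.I * k * contactAngle H u t)) * bergman k u w ∂(liouville V)

/-- `f̂(t) = (2π)⁻¹ ∫ f(x) e^{-itx} dx`, so that `f(x) = ∫ f̂(t) e^{itx} dt`. -/
def fourierHat (f : 𝓢(ℝ, ℂ)) (t : ℝ) : ℂ :=
  (2 * π : ℂ)⁻¹ * ∫ x : ℝ, f x * Complex.exp (-(Complex.I * t * x))

/-! ### Checks that the definitions are well posed -/

theorem omega_hamField {V : Type*} [NormedAddCommGroup V] [InnerProductSpace ℂ V]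
    [FiniteDimensional ℂ V] (H : QuadraticForm ℝ V) (z w : V) :
    omega (hamField H z) w = QuadraticMap.polar H z w := by
  set b := stdOrthonormalBasis ℂ V with hb
  have e : ∀ (r : ℝ) (v : V), r • v = (r : ℂ) • v := fun r v => rfl
  have hw : w = ∑ j, ((inner ℂ (b j) w).re • b j + (inner ℂ (b j) w).im • (Complex.I • b j)) := by
    conv_lhs => rw [← b.sum_repr' w]
    refine Finset.sum_congr rfl fun j _ => ?_
    conv_lhs => rw [← Complex.re_add_im (inner ℂ (b j) w)]
    rw [add_smul, mul_smul]; rfl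
  have hp : QuadraticMap.polar H z w = ∑ j, ((inner ℂ (b j) w).re * QuadraticMap.polar H z (b j)
      + (inner ℂ (b j) w).im * QuadraticMap.polar H z (Complex.I • b j)) := by
    conv_lhs => rw [hw]
    rw [← QuadraticMap.polarBilin_apply_apply, map_sum]
    simp
  rw [hp, omega, hamField]
  simp only [sum_apply, sum_inner, Complex.im_sum, Finset.mul_sum]
  refine Finset.sum_congr rfl fun j _ => ?_
  simp only [← hb, LinearMap.coe_toContinuousLinearMap', LinearMap.add_apply,
    LinearMap.smulRight_apply, LinearMap.flip_apply, QuadraticMap.polarBilin_apply_apply, e,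
    inner_add_left, inner_smul_left]
  have h2 : starRingEnd ℂ (2 : ℂ) = 2 := Complex.conj_ofNat 2
  simp [h2]
  ring

theorem hamFlow_zero {V : Type*} [NormedAddCommGroup V] [InnerProductSpace ℂ V]
    [FiniteDimensional ℂ V] (H : QuadraticForm ℝ V) (z : V) : hamFlow H 0 z = z := by
  simp [hamFlow]

theorem hasDerivAt_hamFlow {V : Type*} [NormedAddCommGroup V] [InnerProductSpace ℂ V]
    [FiniteDimensional ℂ V] (H : QuadraticForm ℝ V) (z : V) (t : ℝ) :
    HasDerivAt (fun s => hamFlow H s z) (hamField H (hamFlow H t z)) t := by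
  have : CompleteSpace V := FiniteDimensional.complete ℂ V
  have h := hasDerivAt_exp_smul_const' (𝕂 := ℝ) (hamField H) t
  exact (ContinuousLinearMap.apply ℝ V z).hasFDerivAt.comp_hasDerivAt t h

theorem omega_hamFlow {V : Type*} [NormedAddCommGroup V] [InnerProductSpace ℂ V]
    [FiniteDimensional ℂ V] (H : QuadraticForm ℝ V) (t : ℝ) (v w : V) :
    omega (hamFlow H t v) (hamFlow H t w) = omega v w := by
  have hsk : ∀ a b : V, omega (hamField H a) b + omega a (hamField H b) = 0 := by
    intro a b
    have hs : omega a (hamField H b) = - omega (hamField H b) a := by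
      simp only [omega]
      rw [← inner_conj_symm a, Complex.conj_im]; ring
    rw [hs, omega_hamField, omega_hamField, QuadraticMap.polar_comm]; ring
  have hd : ∀ s, HasDerivAt (fun s => omega (hamFlow H s v) (hamFlow H s w)) 0 s := by
    intro s
    have h1 := hasDerivAt_hamFlow H v s
    have h2 := hasDerivAt_hamFlow H w s
    have h3 := (Complex.imCLM.hasFDerivAt.comp_hasDerivAt s (h1.inner ℂ h2)).const_mul 2
    have e0 : 2 * Complex.imCLM (inner ℂ (hamFlow H s v) (hamField H (hamFlow H s w)) +
        inner ℂ (hamField H (hamFlow H s v)) (hamFlow H s w)) = 0 := by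
      rw [Complex.imCLM_apply, Complex.add_im]
      have := hsk (hamFlow H s v) (hamFlow H s w)
      simp only [omega] at this
      linarith
    rw [e0] at h3
    exact h3
  have := is_const_of_deriv_eq_zero (fun s => (hd s).differentiableAt) (fun s => (hd s).deriv) t 0
  simpa [hamFlow_zero] using this

theorem det_flowBlock_ne_zero {V : Type*} [NormedAddCommGroup V] [InnerProductSpace ℂ V]
    [FiniteDimensional ℂ V] (H : QuadraticForm ℝ V) (t : ℝ) :
    LinearMap.det (flowBlock H t) ≠ 0 := by
  intro h0
  obtain ⟨v, hv, hv0⟩ := (Submodule.ne_bot_iff _).1 (LinearMap.bot_lt_ker_of_det_eq_zero h0).ne'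
  apply hv0
  have h1 : hamFlow H t v = Complex.I • hamFlow H t (Complex.I • v) := by
    have : (1 / 2 : ℂ) • (hamFlow H t v - Complex.I • hamFlow H t (Complex.I • v)) = 0 := hv
    rw [smul_eq_zero] at this
    rcases this with h | h
    · norm_num at h
    · exact sub_eq_zero.1 h
  have h2 : hamFlow H t (Complex.I • v) = -(Complex.I • hamFlow H t v) := by
    rw [h1, smul_smul, Complex.I_mul_I, neg_one_smul, neg_neg]
  have h3 := omega_hamFlow H t v (Complex.I • v)
  rw [h2] at h3
  simp only [omega, inner_neg_right, inner_smul_right, inner_self_eq_norm_sq_to_K] at h3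
  norm_cast at h3
  simp at h3
  norm_cast at h3
  have := sq_nonneg ‖hamFlow H t v‖
  have h4 : ‖v‖ ^ 2 = 0 := by nlinarith [sq_nonneg ‖v‖]
  simpa using h4

theorem contDiff_det_flowBlock {V : Type*} [NormedAddCommGroup V] [InnerProductSpace ℂ V]
    [FiniteDimensional ℂ V] (H : QuadraticForm ℝ V) :
    ContDiff ℝ 1 (fun t : ℝ => LinearMap.det (flowBlock H t)) := by
  have : CompleteSpace V := FiniteDimensional.complete ℂ V
  have hE : ContDiff ℝ 1 (fun t : ℝ => hamFlow H t) := by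
    rw [contDiff_one_iff_deriv]
    have h := fun t => hasDerivAt_exp_smul_const' (𝕂 := ℝ) (hamField H) t
    refine ⟨fun t => (h t).differentiableAt, ?_⟩
    have hd : deriv (fun t : ℝ => hamFlow H t) = fun t => hamField H * hamFlow H t :=
      funext fun t => (h t).deriv
    rw [hd]
    exact continuous_const.mul
      (continuous_iff_continuousAt.2 fun t => (h t).differentiableAt.continuousAt)
  set b := (stdOrthonormalBasis ℂ V)
  have hdet : (fun t : ℝ => LinearMap.det (flowBlock H t)) = fun t : ℝ =>
      Matrix.det (LinearMap.toMatrix b.toBasis b.toBasis (flowBlock H t)) := by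
    funext t; rw [LinearMap.det_toMatrix]
  rw [hdet]
  simp only [Matrix.det_apply]
  refine ContDiff.sum fun σ _ => ContDiff.const_smul _ (contDiff_prod fun i _ => ?_)
  have : (fun t : ℝ => LinearMap.toMatrix b.toBasis b.toBasis (flowBlock H t) (σ i) i) =
      fun t : ℝ => inner ℂ (b (σ i)) ((1 / 2 : ℂ) • (hamFlow H t (b i)
        - Complex.I • hamFlow H t (Complex.I • b i))) := by
    funext t
    rw [LinearMap.toMatrix_apply]
    simp [b.repr_apply_apply, flowBlock, holBlock]
  rw [this]
  have hv : ∀ v : V, ContDiff ℝ 1 (fun t : ℝ => hamFlow H t v) := fun v =>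
    hE.clm_apply contDiff_const
  exact contDiff_const.inner ℂ (((hv _).sub ((hv _).const_smul Complex.I)).const_smul (1 / 2 : ℂ))

theorem detRoot_zero {V : Type*} [NormedAddCommGroup V] [InnerProductSpace ℂ V]
    [FiniteDimensional ℂ V] (H : QuadraticForm ℝ V) : detRoot H 0 = 1 := by
  simp [detRoot]

theorem hasDerivAt_detRoot {V : Type*} [NormedAddCommGroup V] [InnerProductSpace ℂ V]
    [FiniteDimensional ℂ V] (H : QuadraticForm ℝ V) (t : ℝ) :
    HasDerivAt (detRoot H) (detRoot H t * ((1 / 2 : ℂ) *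
      (deriv (fun r : ℝ => LinearMap.det (flowBlock H r)) t / LinearMap.det (flowBlock H t)))) t := by
  have hc := contDiff_det_flowBlock H
  have hcont : Continuous fun s =>
      deriv (fun r : ℝ => LinearMap.det (flowBlock H r)) s / LinearMap.det (flowBlock H s) :=
    (hc.continuous_deriv le_rfl).div hc.continuous fun s => det_flowBlock_ne_zero H s
  exact ((hcont.integral_hasStrictDerivAt 0 t).hasDerivAt.const_mul (1 / 2 : ℂ)).cexp

theorem detRoot_sq {V : Type*} [NormedAddCommGroup V] [InnerProductSpace ℂ V]
    [FiniteDimensional ℂ V] (H : QuadraticForm ℝ V) (t : ℝ) :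
    detRoot H t ^ 2 = LinearMap.det (flowBlock H t) := by
  have hc := contDiff_det_flowBlock H
  have hne := det_flowBlock_ne_zero H
  have hd : ∀ s, HasDerivAt
      (fun s => detRoot H s ^ 2 / LinearMap.det (flowBlock H s)) 0 s := by
    intro s
    have h1 := (hc.differentiable one_ne_zero s).hasDerivAt
    have h2 := ((hasDerivAt_detRoot H s).pow 2).div h1 (hne s)
    have hs := hne s
    have e0 : ∀ a d c : ℂ, d ≠ 0 →
        ((2 : ℕ) * a ^ (2 - 1) * (a * (1 / 2 * (c / d))) * d - a ^ 2 * c) / d ^ 2 = 0 := by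
      intro a d c hd
      field_simp
      push_cast
      ring
    have h3 := e0 (detRoot H s) _ (deriv (fun r : ℝ => LinearMap.det (flowBlock H r)) s) hs
    rw [← h3]
    exact h2
  have h := is_const_of_deriv_eq_zero (fun s => (hd s).differentiableAt) (fun s => (hd s).deriv) t 0
  have h0 : flowBlock H 0 = LinearMap.id := by
    ext v
    have : flowBlock H 0 v = (1 / 2 : ℂ) • (hamFlow H 0 v
      - Complex.I • hamFlow H 0 (Complex.I • v)) := rfl
    rw [this, hamFlow_zero, hamFlow_zero, smul_smul, Complex.I_mul_I, LinearMap.id_apply]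
    module
  simp only [detRoot_zero, h0, LinearMap.det_id] at h
  rw [div_eq_iff (hne t)] at h
  simpa using h

end

end BargmannFock

/-! ### Laplace's method in one variable, with a complex phase -/

/-! For a quadratic Hamiltonian the propagator on the diagonal is explicit, so only the integral
over `t` needs asymptotics. Euler's identity gives Im⟨z, ξz⟩ = -H(z); hence θ_{z,t} = tH(z), and the
contact lift has zero angle (`contactAngle_eq_zero`). The integral over `V` is then a pure Gaussian,
and U_k(t,z) = (k/2π)^m (det P_t)^{-1/2} e^{kφ(t)} with φ(t) = `graphPhase (hamFlow H t) z`
(`propagator_self`).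

Write g^t = P + N with N antilinear. Symplecticity reads ⟨Pv,Pw⟩ - ⟨Nw,Nv⟩ = ⟨v,w⟩ together with
⟨Nv,Pw⟩ = ⟨Nw,Pv⟩. The complexified graph of g^t contains a unique pair (y, z̄) ↦ (z, x̄), and the
phase is φ = (⟨z,y⟩ + ⟨x,z⟩)/2 - |z|². The block relations give Re φ = -(|z-y|² + |x-z|²)/4, so Re φ
≤ 0 with equality exactly when g^t z = z (`IsSymplectic.re_graphPhase`). At such a time φ = 0, φ' =
iH(z) and φ'' = -⟨α, P^{-1}α⟩ with α = ξz (`hasDerivAt_deriv_graphPhase`); since g^t α = α, the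
number ⟨α, P^{-1}α⟩ has positive real part (`IsSymplectic.re_inner_pos`).

After multiplication by e^{-itEk} with E = H(z), the return times nT are therefore nondegenerate
critical points at which the real part of the phase has its maximum 0. Cut the line into cells of
length T centred at the points nT: each contains one such time, and Laplace's method with complex
phase gives its contribution up to O(k^{-3/2}) (`laplace_expansion`, `exists_cell_bound`). Compact
support of f̂ leaves finitely many cells, and the prefactor (k/2π)^m turns the error into
O(k^{m-3/2}). -/

theorem norm_le_pow_succ_of_norm_deriv_le {f : ℝ → ℂ} (hf : Differentiable ℝ f) (h0 : f 0 = 0)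
    {δ C : ℝ} {n : ℕ} (hC : 0 ≤ C) (h : ∀ s, |s| ≤ δ → ‖deriv f s‖ ≤ C * |s| ^ n) {s : ℝ}
    (hs : |s| ≤ δ) : ‖f s‖ ≤ C * |s| ^ (n + 1) := by
  have key := (convex_closedBall (0 : ℝ) |s|).norm_image_sub_le_of_norm_deriv_le
    (f := f) (C := C * |s| ^ n) (fun x _ => hf x) (fun x hx => by
      have hx' : |x| ≤ |s| := by simpa using hx
      exact (h x (hx'.trans hs)).trans (by gcongr))
    (x := 0) (y := s) (by simp) (by simp)
  rw [h0, sub_zero, sub_zero, Real.norm_eq_abs] at key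
  exact key.trans (le_of_eq (by ring))

/-- Induction on the order: the remainder of f has as derivative the remainder of f' of one order
less, and the mean value inequality gains one power of |s|. The constant is not sharp; only its
uniformity on [-δ, δ] is needed. -/
theorem exists_taylor_bound (δ : ℝ) (n : ℕ) : ∀ {f : ℝ → ℂ}, ContDiff ℝ (n + 1) f →
    ∃ C, 0 ≤ C ∧ ∀ s, |s| ≤ δ →
      ‖f s - ∑ j ∈ Finset.range (n + 1), iteratedDeriv j f 0 / (j.factorial : ℂ) * (s : ℂ) ^ j‖
        ≤ C * |s| ^ (n + 1) := by
  induction n with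
  | zero =>
    intro f hf
    have hf1 : ContDiff ℝ 1 f := by simpa using hf
    obtain ⟨C, hC⟩ := (isCompact_closedBall (0 : ℝ) δ).exists_bound_of_continuousOn
      (hf1.continuous_deriv le_rfl).continuousOn
    refine ⟨max C 0, le_max_right _ _, fun s hs => ?_⟩
    have := norm_le_pow_succ_of_norm_deriv_le (f := fun s => f s - f 0) (n := 0) (δ := δ)
      ((hf1.differentiable one_ne_zero).sub_const _) (by simp) (le_max_right C 0) (fun x hx => by
        rw [deriv_sub_const]
        exact (hC x (by simpa using hx)).trans (by simp)) hs
    simpa using this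
  | succ n ih =>
    intro f hf
    have hf' : ContDiff ℝ ((n + 1 : ℕ) + 1) f := by exact_mod_cast hf
    obtain ⟨hfd, -, hf1⟩ := contDiff_succ_iff_deriv.1 hf'
    obtain ⟨C, hC0, hC⟩ := ih (f := deriv f) (by exact_mod_cast hf1)
    refine ⟨C, hC0, fun s hs => ?_⟩
    have hD : ∀ s : ℝ, HasDerivAt (fun s : ℝ => f s - ∑ j ∈ Finset.range (n + 1 + 1),
        iteratedDeriv j f 0 / (j.factorial : ℂ) * (s : ℂ) ^ j)
        (deriv f s - ∑ j ∈ Finset.range (n + 1),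
          iteratedDeriv j (deriv f) 0 / (j.factorial : ℂ) * (s : ℂ) ^ j) s := by
      intro s
      refine (hfd s).hasDerivAt.sub ?_
      have h1 : ∀ j ∈ Finset.range (n + 1 + 1), HasDerivAt
          (fun s : ℝ => iteratedDeriv j f 0 / (j.factorial : ℂ) * (s : ℂ) ^ j)
          (iteratedDeriv j f 0 / (j.factorial : ℂ) * (j * (s : ℂ) ^ (j - 1))) s := by
        intro j _
        exact ((hasDerivAt_pow j (s : ℂ)).comp_ofReal).const_mul _
      have h2 := HasDerivAt.fun_sum h1
      -- Differentiation kills the constant term and shifts the index, which produces the Taylor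
      -- polynomial of f'.
      rw [Finset.sum_range_succ'] at h2
      convert h2 using 1
      simp only [CharP.cast_eq_zero, zero_mul, mul_zero, add_zero]
      refine Finset.sum_congr rfl fun j _ => ?_
      rw [iteratedDeriv_succ', Nat.factorial_succ]
      have : (j.factorial : ℂ) ≠ 0 := by exact_mod_cast j.factorial_ne_zero
      have : ((j : ℂ) + 1) ≠ 0 := by exact_mod_cast j.succ_ne_zero
      push_cast
      field_simp
    refine norm_le_pow_succ_of_norm_deriv_le (fun s => (hD s).differentiableAt) ?_ hC0
      (fun x hx => ?_) hs
    · rw [Finset.sum_range_succ']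
      simp
    · rw [(hD x).deriv]
      exact hC x hx

/-- The mean value inequality along the segment t ↦ tw, used twice. The factor involves Re w and not
|w|: the Gaussian can absorb e^{Re(kr)}, because the real part of the whole phase is controlled,
whereas e^{|kr|} need not be absorbed on all of [-δ, δ]. -/
theorem norm_exp_sub_one_sub_le (w : ℂ) :
    ‖Complex.exp w - 1 - w‖ ≤ ‖w‖ ^ 2 * max 1 (Real.exp w.re) := by
  have hexp : ∀ t ∈ Set.Icc (0 : ℝ) 1, ‖Complex.exp (t * w)‖ ≤ max 1 (Real.exp w.re) := by
    intro t ht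
    rw [Complex.norm_exp, Complex.re_ofReal_mul]
    rcases le_total w.re 0 with h | h
    · exact le_max_of_le_left (Real.exp_le_one_iff.2 (mul_nonpos_of_nonneg_of_nonpos ht.1 h))
    · exact le_max_of_le_right (Real.exp_le_exp.2 (by nlinarith [ht.2]))
  have hd : ∀ t : ℝ, HasDerivAt (fun t : ℝ => Complex.exp (t * w)) (Complex.exp (t * w) * w) t := by
    intro t
    have : HasDerivAt (fun t : ℝ => (t : ℂ) * w) w t := by
      simpa using (Complex.ofRealCLM.hasDerivAt (x := t)).mul_const w
    exact this.cexp
  have h1 : ∀ t ∈ Set.Icc (0 : ℝ) 1,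
      ‖Complex.exp (t * w) - 1‖ ≤ ‖w‖ * max 1 (Real.exp w.re) := by
    intro t ht
    have := (convex_Icc (0 : ℝ) 1).norm_image_sub_le_of_norm_hasDerivWithin_le
      (f := fun t : ℝ => Complex.exp (t * w)) (fun x _ => (hd x).hasDerivWithinAt)
      (C := ‖w‖ * max 1 (Real.exp w.re)) (fun x hx => by
        rw [norm_mul, mul_comm]; gcongr; exact hexp x hx)
      (x := 0) (y := t) (by simp) ht
    simp only [Complex.ofReal_zero, zero_mul, Complex.exp_zero, sub_zero] at this
    refine this.trans (mul_le_of_le_one_right (by positivity) ?_)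
    rw [Real.norm_eq_abs, abs_of_nonneg ht.1]; exact ht.2
  have h2 := (convex_Icc (0 : ℝ) 1).norm_image_sub_le_of_norm_hasDerivWithin_le
      (f := fun t : ℝ => Complex.exp (t * w) - 1 - t * w)
      (f' := fun t : ℝ => (Complex.exp (t * w) - 1) * w) (fun x _ => by
        have h3 : HasDerivAt (fun t : ℝ => (t : ℂ) * w) w x := by
          simpa using (Complex.ofRealCLM.hasDerivAt (x := x)).mul_const w
        have := (((hd x).sub_const 1).sub h3)
        rw [← sub_one_mul] at this
        exact this.hasDerivWithinAt)
      (C := ‖w‖ ^ 2 * max 1 (Real.exp w.re)) (fun x hx => by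
        rw [norm_mul, pow_two, mul_right_comm]; gcongr; exact h1 x hx)
      (x := 0) (y := 1) (by simp) (by simp)
  simpa using h2

/-- Near 0 the quadratic Taylor term dominates the cubic error; away from 0 compactness gives a
negative upper bound for Re ψ. -/
theorem exists_re_le_neg_sq {ψ : ℝ → ℂ} {δ : ℝ} (hψ : ContDiff ℝ 3 ψ)
    (h0 : (ψ 0).re = 0) (h1 : deriv ψ 0 = 0) {γ : ℂ} (h2 : deriv (deriv ψ) 0 = -γ)
    (hγ : 0 < γ.re) (hneg : ∀ s, |s| ≤ δ → s ≠ 0 → (ψ s).re < 0) :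
    ∃ c, 0 < c ∧ ∀ s, |s| ≤ δ → (ψ s).re ≤ -c * s ^ 2 := by
  obtain ⟨C, hC0, hC⟩ := exists_taylor_bound δ 2 (f := ψ) (by norm_num; exact hψ)
  have hT : ∀ s, |s| ≤ δ → (ψ s).re ≤ -(γ.re / 2) * s ^ 2 + C * |s| ^ 3 := by
    intro s hs
    have := (Complex.re_le_norm _).trans (hC s hs)
    simp only [Finset.sum_range_succ, Finset.sum_range_zero, iteratedDeriv_succ, iteratedDeriv_zero,
      h1, h2] at this
    norm_num at this
    rw [← Complex.ofReal_pow, Complex.ofReal_re, Complex.ofReal_im, h0] at this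
    linarith
  -- Chosen so that for |s| ≤ ε the cubic error costs at most half of the quadratic decay (Re γ / 2)
  -- s².
  set ε := γ.re / (4 * (C + 1)) with hε
  have hε0 : 0 < ε := by positivity
  have hCε : C * ε ≤ γ.re / 4 := by
    rw [hε]
    have h4 : C * (γ.re / (4 * (C + 1))) = (γ.re / 4) * (C / (C + 1)) := by field_simp
    rw [h4]
    exact mul_le_of_le_one_right (by positivity) ((div_le_one (by positivity)).2 (by linarith))
  have hK : IsCompact {s : ℝ | |s| ≤ δ ∧ ε ≤ |s|} := by
    have : {s : ℝ | |s| ≤ δ ∧ ε ≤ |s|} = Metric.closedBall 0 δ ∩ {s : ℝ | ε ≤ |s|} := by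
      ext s; simp
    rw [this]
    exact (isCompact_closedBall _ _).inter_right (isClosed_le continuous_const continuous_abs)
  have hsmall : ∀ s, |s| ≤ δ → |s| ≤ ε → (ψ s).re ≤ -(γ.re / 4) * s ^ 2 := by
    intro s hs hsε
    refine (hT s hs).trans ?_
    have : C * |s| ^ 3 ≤ γ.re / 4 * s ^ 2 := by
      calc C * |s| ^ 3 = C * |s| * |s| ^ 2 := by ring
        _ ≤ C * ε * |s| ^ 2 := by gcongr
        _ ≤ γ.re / 4 * |s| ^ 2 := by gcongr
        _ = _ := by rw [sq_abs]
    linarith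
  -- The annulus ε ≤ |s| ≤ δ is empty when δ < ε. Otherwise Re ψ attains a negative maximum there,
  -- and dividing it by δ² gives a quadratic bound.
  rcases Set.eq_empty_or_nonempty {s : ℝ | |s| ≤ δ ∧ ε ≤ |s|} with hem | hne
  · refine ⟨γ.re / 4, by positivity, fun s hs => hsmall s hs ?_⟩
    by_contra hcon
    exact (Set.eq_empty_iff_forall_notMem.1 hem s) ⟨hs, (not_le.1 hcon).le⟩
  · obtain ⟨s₀, hs₀, hmax⟩ := hK.exists_isMaxOn hne
      (Complex.continuous_re.comp hψ.continuous).continuousOn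
    have hlt : (ψ s₀).re < 0 := hneg s₀ hs₀.1 (abs_pos.1 (hε0.trans_le hs₀.2))
    have hδ : 0 < δ := hε0.trans_le (hs₀.2.trans hs₀.1)
    refine ⟨min (γ.re / 4) (-(ψ s₀).re / δ ^ 2), by
      have : 0 < -(ψ s₀).re := by linarith
      positivity, fun s hs => ?_⟩
    rcases le_total |s| ε with h | h
    · refine (hsmall s hs h).trans ?_
      have := min_le_left (γ.re / 4) (-(ψ s₀).re / δ ^ 2)
      nlinarith [sq_nonneg s]
    · have h5 : (ψ s).re ≤ (ψ s₀).re := hmax ⟨hs, h⟩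
      have h6 := min_le_right (γ.re / 4) (-(ψ s₀).re / δ ^ 2)
      have h7 : s ^ 2 ≤ δ ^ 2 := by rw [← sq_abs s]; gcongr
      have h8 : (-(ψ s₀).re / δ ^ 2) * s ^ 2 ≤ -(ψ s₀).re := by
        rw [div_mul_eq_mul_div, div_le_iff₀ (by positivity)]
        have : 0 < -(ψ s₀).re := by linarith
        gcongr
      nlinarith [sq_nonneg s]

theorem integrable_pow_mul_exp_neg_mul_sq {c : ℝ} (hc : 0 < c) (n : ℕ) :
    Integrable fun s : ℝ => s ^ n * Real.exp (-c * s ^ 2) := by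
  have := integrable_rpow_mul_exp_neg_mul_sq hc (s := n) (by
    have : (0 : ℝ) ≤ n := n.cast_nonneg
    linarith)
  simpa only [Real.rpow_natCast] using this

theorem intervalIntegral_eq_zero_of_odd {f : ℝ → ℂ} (hf : ∀ s, f (-s) = -f s) (δ : ℝ) :
    ∫ s in (-δ)..δ, f s = 0 := by
  have h := intervalIntegral.integral_comp_neg (a := -δ) (b := δ) f
  simp only [hf, intervalIntegral.integral_neg, neg_neg] at h
  exact self_eq_neg.1 h.symm

/-- The Gaussian-weighted polynomial by which all remainders of Laplace's method are bounded. -/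
noncomputable def gaussWeight (c s : ℝ) : ℝ :=
  s ^ 6 * Real.exp (-c * s ^ 2) + s ^ 4 * Real.exp (-c * s ^ 2) + s ^ 2 * Real.exp (-c * s ^ 2)

theorem gaussWeight_nonneg (c s : ℝ) : 0 ≤ gaussWeight c s := by
  unfold gaussWeight
  have : 0 ≤ s ^ 6 := Even.pow_nonneg (by decide) s
  have : 0 ≤ s ^ 4 := Even.pow_nonneg (by decide) s
  positivity

theorem integrable_gaussWeight {c : ℝ} (hc : 0 < c) : Integrable (gaussWeight c) :=
  ((integrable_pow_mul_exp_neg_mul_sq hc 6).add (integrable_pow_mul_exp_neg_mul_sq hc 4)).add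
    (integrable_pow_mul_exp_neg_mul_sq hc 2)

/-- The terms k²s⁶, ks⁴ and s² all have size 1/k on the scale s ~ k^{-1/2}. They are the rescaling
of one fixed integrable weight, so their integrals are O(k^{-3/2}). -/
theorem gaussWeight_sqrt_mul {c k : ℝ} (hk : 0 < k) (s : ℝ) :
    gaussWeight c (√k * s) / k =
      (k ^ 2 * s ^ 6 + k * s ^ 4 + s ^ 2) * Real.exp (-(c * k * s ^ 2)) := by
  have h : √k ^ 2 = k := Real.sq_sqrt hk.le
  have h4 : √k ^ 4 = k ^ 2 := by rw [show 4 = 2 * 2 from rfl, pow_mul, h]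
  have h6 : √k ^ 6 = k ^ 3 := by rw [show 6 = 2 * 3 from rfl, pow_mul, h]
  unfold gaussWeight
  simp only [mul_pow, h, h4, h6]
  rw [show -c * (k * s ^ 2) = -(c * k * s ^ 2) by ring]
  field_simp

theorem integral_gaussWeight_sqrt_mul (c : ℝ) {k : ℝ} (hk : 0 < k) :
    ∫ s, gaussWeight c (√k * s) / k = (∫ s, gaussWeight c s) * k ^ (-(3 / 2) : ℝ) := by
  have e : k ^ (-(3 / 2) : ℝ) = (√k)⁻¹ * k⁻¹ := by
    rw [Real.sqrt_eq_rpow, ← Real.rpow_neg hk.le, ← Real.rpow_neg_one k, ← Real.rpow_add hk]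
    norm_num
  rw [integral_div, Measure.integral_comp_mul_left, abs_of_nonneg (by positivity), smul_eq_mul, e]
  ring

theorem integrable_gaussWeight_sqrt_mul {c k : ℝ} (hc : 0 < c) (hk : 0 < k) :
    Integrable fun s => gaussWeight c (√k * s) / k :=
  ((integrable_gaussWeight hc).comp_mul_left' (Real.sqrt_pos.2 hk).ne').div_const k

/-- Pointwise comparison of the integrand with its Gaussian model. The model retains the odd
corrections a₁s and k a₀ d s³: they are only O(k^{-1/2}) relative to a₀, but they integrate to zero
over a symmetric interval. -/
theorem norm_laplace_remainder_le {q r a a₀ a₁ d : ℂ} {c k s A A₁ A₂ C₃ C₄ : ℝ} (hk : 0 < k)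
    (hA : ‖a‖ ≤ A) (hA₁ : ‖a - a₀‖ ≤ A₁ * |s|) (hA₂ : ‖a - a₀ - a₁ * s‖ ≤ A₂ * |s| ^ 2)
    (hr : ‖r‖ ≤ C₃ * |s| ^ 3) (hr4 : ‖r - d * s ^ 3‖ ≤ C₄ * |s| ^ 4) (hA0 : 0 ≤ A)
    (hA₁0 : 0 ≤ A₁) (hA₂0 : 0 ≤ A₂) (hC₃ : 0 ≤ C₃) (hC₄ : 0 ≤ C₄) (ha₀ : ‖a₀‖ ≤ A)
    (hcq : c ≤ q.re) (hc : (-q * s ^ 2 + r).re ≤ -c * s ^ 2) :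
    ‖a * Complex.exp (k * (-q * s ^ 2 + r)) -
        Complex.exp (-(k * q) * s ^ 2) * (a₀ + (a₁ * s + k * a₀ * d * s ^ 3))‖
      ≤ (A * C₃ ^ 2 + (A₁ * C₃ + A * C₄) + A₂) * (gaussWeight c (√k * s) / k) := by
  rw [gaussWeight_sqrt_mul hk]
  set ε := Real.exp (-(c * k * s ^ 2)) with hε
  have hs2 : ((s : ℂ) ^ 2).re = s ^ 2 := by rw [← Complex.ofReal_pow, Complex.ofReal_re]
  have hs2i : ((s : ℂ) ^ 2).im = 0 := by rw [← Complex.ofReal_pow, Complex.ofReal_im]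
  have hE : ‖Complex.exp (-(k * q) * s ^ 2)‖ ≤ ε := by
    rw [Complex.norm_exp, hε, Real.exp_le_exp, Complex.mul_re, hs2, hs2i, mul_zero, sub_zero,
      Complex.neg_re, Complex.re_ofReal_mul]
    have : 0 ≤ k * s ^ 2 := by positivity
    nlinarith
  have hEr : ‖Complex.exp (-(k * q) * s ^ 2)‖ * max 1 (Real.exp (k * r).re) ≤ ε := by
    rw [mul_max_of_nonneg _ _ (norm_nonneg _), mul_one]
    refine max_le hE ?_
    rw [Complex.norm_exp, ← Real.exp_add, hε, Real.exp_le_exp, ← Complex.add_re,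
      show -(k * q) * (s : ℂ) ^ 2 + k * r = k * (-q * s ^ 2 + r) by ring, Complex.re_ofReal_mul]
    nlinarith
  -- Two errors: the second-order remainder of e^{kr}, of size k²s⁶, and the Taylor errors in the
  -- first-order part a(1 + kr), of sizes ks⁴ and s².
  have hsplit : a * Complex.exp (k * (-q * s ^ 2 + r)) -
      Complex.exp (-(k * q) * s ^ 2) * (a₀ + (a₁ * s + k * a₀ * d * s ^ 3)) =
      a * (Complex.exp (-(k * q) * s ^ 2) * (Complex.exp (k * r) - 1 - k * r)) +
      Complex.exp (-(k * q) * s ^ 2) *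
        (k * ((a - a₀) * r + a₀ * (r - d * s ^ 3)) + (a - a₀ - a₁ * s)) := by
    rw [show (k : ℂ) * (-q * s ^ 2 + r) = -(k * q) * s ^ 2 + k * r by ring, Complex.exp_add]
    ring
  have e6 : |s| ^ 6 = s ^ 6 := Even.pow_abs (by decide) s
  have e4 : |s| ^ 4 = s ^ 4 := Even.pow_abs (by decide) s
  have h1 : ‖a * (Complex.exp (-(k * q) * s ^ 2) * (Complex.exp (k * r) - 1 - k * r))‖
      ≤ A * (ε * (k ^ 2 * (C₃ ^ 2 * s ^ 6))) := by
    rw [norm_mul, norm_mul]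
    have hb := norm_exp_sub_one_sub_le (k * r)
    have : ‖Complex.exp (-(k * q) * s ^ 2)‖ * ‖Complex.exp (k * r) - 1 - k * r‖ ≤
        ε * (k ^ 2 * (C₃ ^ 2 * s ^ 6)) := by
      calc _ ≤ ‖Complex.exp (-(k * q) * s ^ 2)‖ *
              (‖(k * r : ℂ)‖ ^ 2 * max 1 (Real.exp (k * r).re)) := by gcongr
        _ = (‖Complex.exp (-(k * q) * s ^ 2)‖ * max 1 (Real.exp (k * r).re)) *
              ‖(k * r : ℂ)‖ ^ 2 := by ring
        _ ≤ ε * ‖(k * r : ℂ)‖ ^ 2 := by gcongr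
        _ ≤ ε * (k * (C₃ * |s| ^ 3)) ^ 2 := by
            rw [norm_mul, Complex.norm_real, Real.norm_eq_abs, abs_of_pos hk]; gcongr
        _ = ε * (k ^ 2 * (C₃ ^ 2 * |s| ^ 6)) := by ring
        _ = _ := by rw [e6]
    gcongr
  have h2 : ‖Complex.exp (-(k * q) * s ^ 2) *
        (k * ((a - a₀) * r + a₀ * (r - d * s ^ 3)) + (a - a₀ - a₁ * s))‖ ≤
      ε * (k * ((A₁ * C₃ + A * C₄) * s ^ 4) + A₂ * s ^ 2) := by
    rw [norm_mul]
    have hx : ‖(a - a₀) * r + a₀ * (r - d * s ^ 3)‖ ≤ (A₁ * C₃ + A * C₄) * s ^ 4 := by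
      calc _ ≤ ‖a - a₀‖ * ‖r‖ + ‖a₀‖ * ‖r - d * s ^ 3‖ := by
              refine (norm_add_le _ _).trans ?_
              rw [norm_mul, norm_mul]
        _ ≤ A₁ * |s| * (C₃ * |s| ^ 3) + A * (C₄ * |s| ^ 4) := by gcongr
        _ = (A₁ * C₃ + A * C₄) * |s| ^ 4 := by ring
        _ = _ := by rw [e4]
    have : ‖(k : ℂ) * ((a - a₀) * r + a₀ * (r - d * s ^ 3)) + (a - a₀ - a₁ * s)‖ ≤
        k * ((A₁ * C₃ + A * C₄) * s ^ 4) + A₂ * s ^ 2 := by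
      refine (norm_add_le _ _).trans ?_
      rw [norm_mul, Complex.norm_real, Real.norm_eq_abs, abs_of_pos hk]
      rw [sq_abs] at hA₂
      gcongr
    gcongr
  rw [hsplit]
  refine (norm_add_le _ _).trans ((add_le_add h1 h2).trans ?_)
  have hε0 : 0 ≤ ε := (Real.exp_pos _).le
  have p6 : 0 ≤ s ^ 6 := Even.pow_nonneg (by decide) s
  have p4 : 0 ≤ s ^ 4 := Even.pow_nonneg (by decide) s
  -- These are the cross terms by which the product of the constants with the whole weight exceeds
  -- the bounds `h1` and `h2`.
  have : 0 ≤ (A * C₃ ^ 2) * (ε * (k * s ^ 4)) + (A * C₃ ^ 2) * (ε * s ^ 2) +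
      (A₁ * C₃ + A * C₄) * (ε * (k ^ 2 * s ^ 6)) + (A₁ * C₃ + A * C₄) * (ε * s ^ 2) +
      A₂ * (ε * (k ^ 2 * s ^ 6)) + A₂ * (ε * (k * s ^ 4)) := by positivity
  nlinarith [this]

theorem norm_integral_gauss_tail_le {q : ℂ} {c k δ : ℝ} (hc : 0 < c) (hcq : c ≤ q.re) (hk : 0 < k)
    (hδ : 0 < δ) :
    ‖(∫ s in (-δ)..δ, Complex.exp (-(k * q) * s ^ 2)) - (π / (k * q)) ^ (1 / 2 : ℂ)‖
      ≤ (1 / δ ^ 2) * (∫ s, gaussWeight c s) * k ^ (-(3 / 2) : ℝ) := by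
  have hq : 0 < q.re := hc.trans_le hcq
  have hre : 0 < ((k : ℂ) * q).re := by rw [Complex.re_ofReal_mul]; positivity
  have hint := integrable_cexp_neg_mul_sq hre
  have hδδ : -δ ≤ δ := by linarith
  rw [← integral_gaussian_complex hre, intervalIntegral.integral_of_le hδδ,
    ← integral_add_compl (measurableSet_Ioc (a := -δ) (b := δ)) hint, sub_add_cancel_left, norm_neg]
  -- Outside the interval 1 ≤ s²/δ², so the tail is dominated by the s² part of the weight.
  have hpt : ∀ s ∈ (Set.Ioc (-δ) δ)ᶜ, ‖Complex.exp (-(k * q) * s ^ 2)‖ ≤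
      (1 / δ ^ 2) * (gaussWeight c (√k * s) / k) := by
    intro s hs
    have hs' : δ ≤ |s| := by
      by_contra hcon
      obtain ⟨h1, h2⟩ := abs_lt.1 (not_le.1 hcon)
      exact hs ⟨h1, h2.le⟩
    have h2 : δ ^ 2 ≤ s ^ 2 := by rw [← sq_abs s]; gcongr
    rw [gaussWeight_sqrt_mul hk]
    have hE : ‖Complex.exp (-(k * q) * s ^ 2)‖ ≤ Real.exp (-(c * k * s ^ 2)) := by
      rw [Complex.norm_exp, Real.exp_le_exp, ← Complex.ofReal_pow, Complex.re_mul_ofReal,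
        Complex.neg_re, Complex.re_ofReal_mul]
      have : 0 ≤ k * s ^ 2 := by positivity
      nlinarith
    refine hE.trans ?_
    rw [← mul_assoc]
    refine le_mul_of_one_le_left (Real.exp_pos _).le ?_
    rw [one_div_mul_eq_div, one_le_div (by positivity)]
    have p6 : 0 ≤ s ^ 6 := Even.pow_nonneg (by decide) s
    have p4 : 0 ≤ s ^ 4 := Even.pow_nonneg (by decide) s
    have : 0 ≤ k ^ 2 * s ^ 6 + k * s ^ 4 := by positivity
    linarith
  have hmaj := (integrable_gaussWeight_sqrt_mul hc hk).const_mul (1 / δ ^ 2)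
  refine (norm_integral_le_integral_norm _).trans ?_
  refine (setIntegral_mono_on hint.norm.integrableOn hmaj.integrableOn
    measurableSet_Ioc.compl hpt).trans ?_
  refine (setIntegral_le_integral hmaj (Eventually.of_forall fun s => ?_)).trans ?_
  · have := gaussWeight_nonneg c (√k * s)
    positivity
  · rw [integral_const_mul, integral_gaussWeight_sqrt_mul c hk, mul_assoc]

/-- Four derivatives of ψ and two of a reach the first odd correction with an error one further
power of s. The odd correction drops out, so the error is O(k^{-3/2}) and not merely O(k^{-1}). -/
theorem laplace_expansion {a ψ : ℝ → ℂ} {δ : ℝ} (hδ : 0 < δ) (ha : ContDiff ℝ 2 a)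
    (hψ : ContDiff ℝ 4 ψ) (h0 : (ψ 0).re = 0) (h1 : deriv ψ 0 = 0) {γ : ℂ}
    (h2 : deriv (deriv ψ) 0 = -γ) (hγ : 0 < γ.re)
    (hneg : ∀ s, |s| ≤ δ → s ≠ 0 → (ψ s).re < 0) :
    ∃ C, ∀ k : ℕ, 0 < k →
      ‖(∫ s in (-δ)..δ, a s * Complex.exp (k * ψ s)) -
          a 0 * Complex.exp (k * ψ 0) * (2 * π / (k * γ)) ^ (1 / 2 : ℂ)‖
        ≤ C * (k : ℝ) ^ (-(3 / 2) : ℝ) := by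
  obtain ⟨c', hc', hcψ⟩ := exists_re_le_neg_sq (hψ.of_le (by norm_num)) h0 h1 h2 hγ hneg
  obtain ⟨C₃, hC₃, hT₃⟩ := exists_taylor_bound δ 2 (f := ψ) (by
    norm_num; exact hψ.of_le (by norm_num))
  obtain ⟨C₄, hC₄, hT₄⟩ := exists_taylor_bound δ 3 (f := ψ) (by norm_num; exact hψ)
  obtain ⟨A₁, hA₁, hTA₁⟩ := exists_taylor_bound δ 0 (f := a) (by
    norm_num; exact ha.of_le (by norm_num))
  obtain ⟨A₂, hA₂, hTA₂⟩ := exists_taylor_bound δ 1 (f := a) (by norm_num; exact ha)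
  obtain ⟨A, hA⟩ := (isCompact_closedBall (0 : ℝ) δ).exists_bound_of_continuousOn
    ha.continuous.continuousOn
  have hAs : ∀ s, |s| ≤ δ → ‖a s‖ ≤ A := fun s hs => hA s (by simpa using hs)
  have ha0 : ‖a 0‖ ≤ A := hAs 0 (by simpa using hδ.le)
  have hA0 : 0 ≤ A := (norm_nonneg _).trans ha0
  set q := γ / 2 with hq
  have hqre : q.re = γ.re / 2 := by simp [hq]
  have hqpos : 0 < q.re := by rw [hqre]; positivity
  set c := min c' q.re with hc
  have hcpos : 0 < c := lt_min hc' hqpos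
  set d := iteratedDeriv 3 ψ 0 / 6 with hd
  set r : ℝ → ℂ := fun s => ψ s - ψ 0 + q * s ^ 2 with hr
  have hr3 : ∀ s, |s| ≤ δ → ‖r s‖ ≤ C₃ * |s| ^ 3 := by
    intro s hs
    have := hT₃ s hs
    simp only [Finset.sum_range_succ, Finset.sum_range_zero, iteratedDeriv_succ, iteratedDeriv_zero,
      h1, h2] at this
    convert this using 2
    simp [hr, hq]
    ring
  have hr4 : ∀ s, |s| ≤ δ → ‖r s - d * s ^ 3‖ ≤ C₄ * |s| ^ 4 := by
    intro s hs
    have := hT₄ s hs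
    simp only [Finset.sum_range_succ, Finset.sum_range_zero] at this
    have e2 : iteratedDeriv 2 ψ 0 = -γ := by
      simp only [iteratedDeriv_succ, iteratedDeriv_zero, h2]
    have e1 : iteratedDeriv 1 ψ 0 = 0 := by
      simp only [iteratedDeriv_succ, iteratedDeriv_zero, h1]
    rw [e2, e1] at this
    convert this using 2
    simp [hr, hq, hd, Nat.factorial]
    ring
  set W := A * C₃ ^ 2 + (A₁ * C₃ + A * C₄) + A₂ with hW
  set I := ∫ s, gaussWeight c s with hI
  refine ⟨W * I + A * ((1 / δ ^ 2) * I), fun k hk => ?_⟩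
  have hk' : (0 : ℝ) < k := by exact_mod_cast hk
  have hδδ : -δ ≤ δ := by linarith
  set D : ℝ → ℂ := fun s => Complex.exp (-((k : ℝ) * q) * s ^ 2) *
    (a 0 + (deriv a 0 * s + (k : ℝ) * a 0 * d * s ^ 3)) with hD
  set B : ℝ → ℂ := fun s => a s * Complex.exp ((k : ℝ) * (-q * s ^ 2 + r s)) with hB
  have hrc : Continuous r := by
    have := hψ.continuous
    simp only [hr]; fun_prop
  have hBc : Continuous B := by
    have := ha.continuous
    simp only [hB]; fun_prop
  have hDc : Continuous D := by simp only [hD]; fun_prop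
  have hrem : ‖∫ s in (-δ)..δ, (B s - D s)‖ ≤ W * I * (k : ℝ) ^ (-(3 / 2) : ℝ) := by
    have hmaj := (integrable_gaussWeight_sqrt_mul hcpos hk').const_mul W
    have hpt : ∀ s ∈ Set.Ioc (-δ) δ, ‖B s - D s‖ ≤ W * (gaussWeight c (√k * s) / k) := by
      intro s hs
      have hs' : |s| ≤ δ := abs_le.2 ⟨hs.1.le, hs.2⟩
      refine norm_laplace_remainder_le hk' (hAs s hs') ?_ ?_ (hr3 s hs') (hr4 s hs') hA0 hA₁ hA₂
        hC₃ hC₄ ha0 (min_le_right _ _) ?_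
      · simpa using hTA₁ s hs'
      · have := hTA₂ s hs'
        simp only [Finset.sum_range_succ, Finset.sum_range_zero, iteratedDeriv_succ,
          iteratedDeriv_zero] at this
        convert this using 2
        simp
        ring
      · have e : -q * (s : ℂ) ^ 2 + r s = ψ s - ψ 0 := by simp only [hr]; ring
        rw [e, Complex.sub_re, h0, sub_zero]
        refine (hcψ s hs').trans ?_
        have := min_le_left c' q.re
        nlinarith [sq_nonneg s]
    refine (intervalIntegral.norm_integral_le_of_norm_le hδδ
      (Eventually.of_forall hpt) hmaj.intervalIntegrable).trans ?_
    rw [intervalIntegral.integral_of_le hδδ]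
    have hW0 : 0 ≤ W := by positivity
    refine (setIntegral_le_integral hmaj (Eventually.of_forall fun s => ?_)).trans ?_
    · have := gaussWeight_nonneg c (√k * s)
      positivity
    · rw [integral_const_mul, integral_gaussWeight_sqrt_mul c hk', mul_assoc]
  have hDint : ∫ s in (-δ)..δ, D s =
      a 0 * ∫ s in (-δ)..δ, Complex.exp (-((k : ℝ) * q) * s ^ 2) := by
    have e : D = fun s : ℝ => a 0 * Complex.exp (-((k : ℝ) * q) * s ^ 2) +
        Complex.exp (-((k : ℝ) * q) * s ^ 2) * (deriv a 0 * s + (k : ℝ) * a 0 * d * s ^ 3) := by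
      funext s; simp only [hD]; ring
    rw [e, intervalIntegral.integral_add
      (Continuous.intervalIntegrable (by fun_prop) _ _)
      (Continuous.intervalIntegrable (by fun_prop) _ _),
      intervalIntegral.integral_const_mul, intervalIntegral_eq_zero_of_odd (f := fun s : ℝ =>
        Complex.exp (-((k : ℝ) * q) * s ^ 2) * (deriv a 0 * s + (k : ℝ) * a 0 * d * s ^ 3)),
      add_zero]
    intro s
    push_cast
    rw [neg_sq]
    ring
  have hmain : (∫ s in (-δ)..δ, a s * Complex.exp (k * ψ s)) =
      Complex.exp (k * ψ 0) * ∫ s in (-δ)..δ, B s := by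
    rw [← intervalIntegral.integral_const_mul]
    refine intervalIntegral.integral_congr fun s _ => ?_
    simp only [hB]
    rw [mul_left_comm, ← Complex.exp_add]
    congr 2
    simp only [hr]
    push_cast
    ring
  -- Only Re ψ(0) = 0 is assumed: e^{kψ(0)} is an oscillating factor of modulus one that can be
  -- pulled out of the estimate.
  have hunit : ‖Complex.exp (k * ψ 0)‖ = 1 := by
    rw [Complex.norm_exp, ← Complex.ofReal_natCast, Complex.re_ofReal_mul, h0]; simp
  have hqk : (2 * π / (k * γ) : ℂ) = π / ((k : ℝ) * q) := by
    have : γ ≠ 0 := by rintro rfl; simp at hγ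
    have : (k : ℂ) ≠ 0 := by exact_mod_cast hk.ne'
    rw [hq]; push_cast; field_simp
  have htail := norm_integral_gauss_tail_le hcpos (min_le_right c' q.re) hk' hδ
  have hsplit : (∫ s in (-δ)..δ, B s) - a 0 * (π / ((k : ℝ) * q)) ^ (1 / 2 : ℂ) =
      (∫ s in (-δ)..δ, (B s - D s)) +
        a 0 * ((∫ s in (-δ)..δ, Complex.exp (-((k : ℝ) * q) * s ^ 2)) -
          (π / ((k : ℝ) * q)) ^ (1 / 2 : ℂ)) := by
    rw [intervalIntegral.integral_sub (hBc.intervalIntegrable _ _) (hDc.intervalIntegrable _ _),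
      hDint]
    ring
  rw [hmain, hqk, show a 0 * Complex.exp (k * ψ 0) * ((π : ℂ) / ((k : ℝ) * q)) ^ (1 / 2 : ℂ) =
    Complex.exp (k * ψ 0) * (a 0 * (π / ((k : ℝ) * q)) ^ (1 / 2 : ℂ)) by ring, ← mul_sub, norm_mul,
    hunit, one_mul, hsplit]
  refine (norm_add_le _ _).trans ?_
  rw [norm_mul, add_mul]
  refine add_le_add hrem ?_
  rw [mul_assoc A]
  gcongr

/-! ### Gaussian integrals -/

/-- The Gaussian integral of a real positive definite quadratic form with a complex linear term. -/
theorem integral_cexp_neg_quadratic_add_linear {W : Type*} [NormedAddCommGroup W]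
    [InnerProductSpace ℝ W] [FiniteDimensional ℝ W] [MeasurableSpace W] [BorelSpace W]
    {M : W →ₗ[ℝ] W} (hM : M.IsSymmetric) (hpos : ∀ u, u ≠ 0 → 0 < inner ℝ (M u) u)
    (L : W →ₗ[ℝ] ℂ) {a b : W} (ha : ∀ u, (L u).re = inner ℝ (M a) u)
    (hb : ∀ u, (L u).im = inner ℝ (M b) u) {k : ℝ} (hk : 0 < k) :
    ∫ u, Complex.exp (k * (-(inner ℝ (M u) u : ℝ) + L u)) =
      (√((π / k) ^ Module.finrank ℝ W / LinearMap.det M) : ℝ) *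
        Complex.exp (k / 4 * (L a + Complex.I * L b)) := by
  set n := Module.finrank ℝ W with hn
  set e := hM.eigenvectorBasis hn.symm with he
  set l := hM.eigenvalues hn.symm with hl
  have hMe : ∀ i, M (e i) = l i • e i := fun i => hM.apply_eigenvectorBasis hn.symm i
  have hlpos : ∀ i, 0 < l i := by
    intro i
    have h1 := hpos (e i) (e.orthonormal.ne_zero i)
    rwa [hMe, real_inner_smul_left, real_inner_self_eq_norm_sq, e.orthonormal.1 i, one_pow,
      mul_one] at h1
  have hexp : ∀ u, u = ∑ i, (inner ℝ (e i) u) • e i := fun u => (e.sum_repr' u).symm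
  -- The coordinates of a + ib in an eigenbasis of M. There the exponent is a sum of one-variable
  -- terms k l_i(-v_i² + c_i v_i), and the integral factors.
  set c : Fin n → ℂ := fun i => (inner ℝ (e i) a : ℝ) + Complex.I * (inner ℝ (e i) b : ℝ) with hc
  have hMsymm : ∀ x i, inner ℝ (M x) (e i) = l i * inner ℝ (e i) x := by
    intro x i
    rw [hM x (e i), hMe, real_inner_smul_right, real_inner_comm]
  have hLe : ∀ i, L (e i) = l i * c i := by
    intro i
    apply Complex.ext
    · rw [ha, hMsymm, Complex.re_ofReal_mul]; simp [hc]
    · rw [hb, hMsymm, Complex.im_ofReal_mul]; simp [hc]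
  have hL : ∀ u, L u = ∑ i, (inner ℝ (e i) u : ℝ) * (l i * c i) := by
    intro u
    conv_lhs => rw [hexp u]
    simp [hLe]
  have hQ : ∀ u, inner ℝ (M u) u = ∑ i, l i * (inner ℝ (e i) u) ^ 2 := by
    intro u
    rw [← e.sum_inner_mul_inner (M u) u]
    refine Finset.sum_congr rfl fun i _ => ?_
    rw [hMsymm]; ring
  have hLab : L a + Complex.I * L b = ∑ i, l i * c i ^ 2 := by
    rw [hL, hL, Finset.mul_sum, ← Finset.sum_add_distrib]
    refine Finset.sum_congr rfl fun i _ => ?_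
    simp only [hc]; ring
  have hmp : MeasurePreserving (fun v : Fin n → ℝ => e.repr.symm (WithLp.toLp 2 v)) :=
    e.measurePreserving_repr_symm.comp (PiLp.volume_preserving_toLp (Fin n))
  have hemb : MeasurableEmbedding (fun v : Fin n → ℝ => e.repr.symm (WithLp.toLp 2 v)) :=
    e.repr.symm.toHomeomorph.measurableEmbedding.comp
      (MeasurableEquiv.toLp 2 (Fin n → ℝ)).measurableEmbedding
  rw [← hmp.integral_comp hemb]
  have hin : ∀ (v : Fin n → ℝ) i, inner ℝ (e i) (e.repr.symm (WithLp.toLp 2 v)) = v i := by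
    intro v i
    rw [← e.repr_apply_apply, LinearIsometryEquiv.apply_symm_apply]
  have hform : ∀ v : Fin n → ℝ, (k : ℂ) * (-(inner ℝ (M (e.repr.symm (WithLp.toLp 2 v)))
        (e.repr.symm (WithLp.toLp 2 v)) : ℝ) + L (e.repr.symm (WithLp.toLp 2 v))) =
      -∑ i, ((k * l i : ℝ) : ℂ) * (v i : ℂ) ^ 2 + ∑ i, ((k * l i : ℝ) : ℂ) * c i * v i := by
    intro v
    rw [hQ, hL]
    simp only [hin]
    push_cast
    rw [mul_add, mul_neg, Finset.mul_sum, Finset.mul_sum]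
    congr 1
    · congr 1
      exact Finset.sum_congr rfl fun i _ => by ring
    · exact Finset.sum_congr rfl fun i _ => by ring
  simp only [hform]
  have hkl : ∀ i, 0 < k * l i := fun i => mul_pos hk (hlpos i)
  rw [GaussianFourier.integral_cexp_neg_sum_mul_add (b := fun i => ((k * l i : ℝ) : ℂ))
    (fun i => by simpa using hkl i), Finset.prod_mul_distrib, ← Complex.exp_sum, hLab]
  congr 1
  · have h1 : ∀ i, ((π : ℂ) / ((k * l i : ℝ) : ℂ)) ^ (1 / 2 : ℂ) = (√(π / (k * l i)) : ℝ) := by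
      intro i
      rw [Real.sqrt_eq_rpow, Complex.ofReal_cpow (div_nonneg Real.pi_pos.le (hkl i).le)]
      push_cast
      rfl
    simp only [h1]
    rw [← Complex.ofReal_prod, ← Real.sqrt_prod _ fun i _ => div_nonneg Real.pi_pos.le (hkl i).le]
    congr 2
    rw [hM.det_eq_prod_eigenvalues hn.symm]
    simp only [← div_div]
    rw [Finset.prod_div_distrib, Finset.prod_const, Finset.card_univ, Fintype.card_fin]
    rfl
  · rw [Finset.mul_sum]
    congr 1
    refine Finset.sum_congr rfl fun i _ => ?_
    have : ((k * l i : ℝ) : ℂ) ≠ 0 := by exact_mod_cast (hkl i).ne'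
    have h2 : (((k * l i : ℝ) : ℂ) * c i) ^ 2 / (4 * ((k * l i : ℝ) : ℂ)) =
        ((k * l i : ℝ) : ℂ) * c i ^ 2 / 4 := by field_simp
    rw [h2]
    push_cast
    ring

/-! ### The Liouville measure as a multiple of Lebesgue measure -/

namespace BargmannFock

attribute [local instance] InnerProductSpace.complexToReal

theorem finrank_real_eq (V : Type*) [NormedAddCommGroup V] [InnerProductSpace ℂ V]
    [FiniteDimensional ℂ V] : Module.finrank ℝ V = 2 * Module.finrank ℂ V :=
  finrank_real_of_complex V

/-- The pushforward from unitary coordinates is a Haar measure, hence a multiple of the volume of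
the real Euclidean structure. Integrating e^{-|v|²}, which gives π^m on both sides, shows that the
multiple is 1. -/
theorem liouville_eq (V : Type*) [NormedAddCommGroup V] [InnerProductSpace ℂ V]
    [FiniteDimensional ℂ V] [MeasurableSpace V] [BorelSpace V] :
    liouville V = (2 : ENNReal) ^ Module.finrank ℂ V • (volume : Measure V) := by
  set m := Module.finrank ℂ V with hm
  set b := stdOrthonormalBasis ℂ V with hb
  let E : (Fin m → ℂ) ≃L[ℝ] V :=
    ((b.toBasis.equivFun.symm).restrictScalars ℝ).toContinuousLinearEquiv
  have hE : (fun c : Fin m → ℂ => ∑ j, c j • b j) = E := by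
    funext c
    change _ = b.toBasis.equivFun.symm c
    rw [Module.Basis.equivFun_symm_apply]
    simp only [OrthonormalBasis.coe_toBasis]
    rfl
  set μ : Measure V := (volume : Measure (Fin m → ℂ)).map E with hμ
  have hhaar : μ.IsAddHaarMeasure := E.isAddHaarMeasure_map volume
  have hmain : liouville V = (2 : ENNReal) ^ m • μ := by rw [liouville, hμ, ← hE]
  rw [hmain]
  congr 1
  have hsmul := Measure.isAddLeftInvariant_eq_smul μ (volume : Measure V)
  set κ := μ.addHaarScalarFactor (volume : Measure V) with hκ
  have hμi : ∫ v, Real.exp (-1 * ‖v‖ ^ 2) ∂μ = π ^ m := by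
    have hemb : MeasurableEmbedding E := E.toHomeomorph.measurableEmbedding
    rw [hμ, hemb.integral_map]
    have h1 : ∀ c : Fin m → ℂ, Real.exp (-1 * ‖E c‖ ^ 2) = ∏ j, Real.exp (-1 * ‖c j‖ ^ 2) := by
      intro c
      have h2 : E c = b.repr.symm (WithLp.toLp 2 c) := by
        rw [← hE]; exact b.sum_repr_symm (WithLp.toLp 2 c)
      rw [h2, LinearIsometryEquiv.norm_map, EuclideanSpace.norm_sq_eq, Finset.mul_sum,
        Real.exp_sum]
    change ∫ c, Real.exp (-1 * ‖E c‖ ^ 2) = _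
    simp only [h1]
    rw [integral_fintype_prod_volume_eq_prod (f := fun _ (x : ℂ) => Real.exp (-1 * ‖x‖ ^ 2)),
      GaussianFourier.integral_rexp_neg_mul_sq_norm one_pos]
    simp
  have hvi : ∫ v : V, Real.exp (-1 * ‖v‖ ^ 2) = π ^ m := by
    rw [GaussianFourier.integral_rexp_neg_mul_sq_norm one_pos, finrank_real_eq, ← hm]
    simp
  rw [hsmul, integral_smul_nnreal_measure, hvi] at hμi
  have hκ1 : κ = 1 := by
    have : (κ : ℝ) * π ^ m = 1 * π ^ m := by rw [one_mul]; exact hμi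
    exact_mod_cast mul_right_cancel₀ (by positivity) this
  rw [hsmul, hκ1, one_smul]

end BargmannFock

namespace BargmannFock

section Blocks

variable {V : Type*} [NormedAddCommGroup V] [InnerProductSpace ℂ V]

/-! ### Complex-linear and antilinear parts of real-linear maps -/

/-- Multiplication by `i` as a real-linear map. -/
noncomputable def mulI (V : Type*) [NormedAddCommGroup V] [InnerProductSpace ℂ V] : V →L[ℝ] V :=
  Complex.I • ContinuousLinearMap.id ℝ V

@[simp] theorem mulI_apply (v : V) : mulI V v = Complex.I • v := rfl

/-- The complex-linear part of a real-linear map. -/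
noncomputable def linPart (S : V →L[ℝ] V) : V →L[ℝ] V :=
  (1 / 2 : ℝ) • (S - mulI V * S * mulI V)

/-- The antilinear part of a real-linear map. -/
noncomputable def antiPart (S : V →L[ℝ] V) : V →L[ℝ] V :=
  (1 / 2 : ℝ) • (S + mulI V * S * mulI V)

theorem real_smul_eq (r : ℝ) (v : V) : r • v = (r : ℂ) • v := rfl

theorem I_smul_I_smul (v : V) : Complex.I • Complex.I • v = -v := by
  rw [smul_smul, Complex.I_mul_I, neg_one_smul]

theorem linPart_apply (S : V →L[ℝ] V) (v : V) :
    linPart S v = (1 / 2 : ℝ) • (S v - Complex.I • S (Complex.I • v)) := rfl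

theorem antiPart_apply (S : V →L[ℝ] V) (v : V) :
    antiPart S v = (1 / 2 : ℝ) • (S v + Complex.I • S (Complex.I • v)) := rfl

theorem holBlock_apply (S : V →L[ℝ] V) (v : V) : holBlock S v = linPart S v := by
  rw [linPart_apply, real_smul_eq]
  change (1 / 2 : ℂ) • (S v - Complex.I • S (Complex.I • v)) = _
  norm_num

theorem linPart_add_antiPart (S : V →L[ℝ] V) (v : V) : linPart S v + antiPart S v = S v := by
  rw [linPart_apply, antiPart_apply]
  module

theorem linPart_I_smul (S : V →L[ℝ] V) (v : V) :
    linPart S (Complex.I • v) = Complex.I • linPart S v := by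
  rw [linPart_apply, linPart_apply, I_smul_I_smul, map_neg, smul_comm Complex.I (1 / 2 : ℝ)]
  simp only [smul_sub, smul_neg, I_smul_I_smul]
  module

theorem antiPart_I_smul (S : V →L[ℝ] V) (v : V) :
    antiPart S (Complex.I • v) = -(Complex.I • antiPart S v) := by
  rw [antiPart_apply, antiPart_apply, I_smul_I_smul, map_neg, smul_comm Complex.I (1 / 2 : ℝ)]
  simp only [smul_add, smul_neg, I_smul_I_smul]
  module

theorem linPart_comp (A B : V →L[ℝ] V) (v : V) :
    linPart (A * B) v = linPart A (linPart B v) + antiPart A (antiPart B v) := by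
  rw [linPart_apply (A * B), mul_apply_eq_comp, mul_apply_eq_comp,
    ← linPart_add_antiPart B, ← linPart_add_antiPart B, linPart_I_smul, antiPart_I_smul,
    ← linPart_add_antiPart A, ← linPart_add_antiPart A]
  simp only [map_add, map_neg, linPart_I_smul, antiPart_I_smul, smul_add, smul_neg, I_smul_I_smul]
  module

theorem antiPart_comp (A B : V →L[ℝ] V) (v : V) :
    antiPart (A * B) v = linPart A (antiPart B v) + antiPart A (linPart B v) := by
  have h1 := linPart_add_antiPart (A * B) v
  rw [linPart_comp, mul_apply_eq_comp, ← linPart_add_antiPart B,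
    ← linPart_add_antiPart A, map_add, map_add] at h1
  have : antiPart (A * B) v = (linPart A (linPart B v) + antiPart A (antiPart B v) +
    antiPart (A * B) v) - (linPart A (linPart B v) + antiPart A (antiPart B v)) := by abel
  rw [this, h1]
  abel

/-- The imaginary part at iw is the real part at w. This promotes identities for the symplectic form
to identities for the Hermitian product. -/
theorem eq_of_im_eq {f g : V → ℂ} (hf : ∀ w, f (Complex.I • w) = Complex.I * f w)
    (hg : ∀ w, g (Complex.I • w) = Complex.I * g w) (h : ∀ w, (f w).im = (g w).im) (w : V) :
    f w = g w := by
  refine Complex.ext ?_ (h w)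
  have := h (Complex.I • w)
  rw [hf, hg] at this
  simpa using this

/-! ### Blocks of symplectic maps -/

/-- `S` preserves the symplectic form, that is, the imaginary part of the inner product. -/
def IsSymplectic (S : V →L[ℝ] V) : Prop :=
  ∀ v w, (inner ℂ (S v) (S w)).im = (inner ℂ v w).im

/-- `ξ` is infinitesimally symplectic. -/
def IsInfSymplectic (ξ : V →L[ℝ] V) : Prop :=
  ∀ v w, (inner ℂ (ξ v) w).im + (inner ℂ v (ξ w)).im = 0

theorem I_smul_inner_I_smul (v w : V) :
    inner ℂ (Complex.I • v) (Complex.I • w) = inner ℂ v w := by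
  rw [inner_smul_left, inner_smul_right, ← mul_assoc, Complex.conj_I]
  simp

/-- Replacing (v, w) by (iv, iw) preserves the pure terms and changes the sign of the mixed ones, so
the two groups separate. -/
theorem IsSymplectic.im_blocks {S : V →L[ℝ] V} (hS : IsSymplectic S) (v w : V) :
    (inner ℂ (linPart S v) (linPart S w)).im + (inner ℂ (antiPart S v) (antiPart S w)).im =
      (inner ℂ v w).im ∧
    (inner ℂ (linPart S v) (antiPart S w)).im + (inner ℂ (antiPart S v) (linPart S w)).im = 0 := by
  have h1 := hS v w
  have h2 := hS (Complex.I • v) (Complex.I • w)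
  simp only [← linPart_add_antiPart S, linPart_I_smul, antiPart_I_smul, inner_add_left,
    inner_add_right, inner_neg_left, inner_neg_right, I_smul_inner_I_smul, Complex.add_im,
    Complex.neg_im] at h1 h2
  constructor <;> linarith

theorem IsSymplectic.inner_linPart_sub {S : V →L[ℝ] V} (hS : IsSymplectic S) (v w : V) :
    inner ℂ (linPart S v) (linPart S w) - inner ℂ (antiPart S w) (antiPart S v) = inner ℂ v w := by
  refine eq_of_im_eq (f := fun w => inner ℂ (linPart S v) (linPart S w) -
    inner ℂ (antiPart S w) (antiPart S v)) (g := fun w => inner ℂ v w) ?_ ?_ ?_ w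
  · intro w
    simp only [linPart_I_smul, antiPart_I_smul, inner_neg_left, inner_smul_right, inner_smul_left,
      Complex.conj_I]
    ring
  · intro w
    simp only [inner_smul_right]
  · intro w
    have := (hS.im_blocks v w).1
    rw [← inner_conj_symm (antiPart S v), Complex.conj_im] at this
    rw [Complex.sub_im]
    linarith

theorem IsSymplectic.inner_antiPart_linPart {S : V →L[ℝ] V} (hS : IsSymplectic S) (v w : V) :
    inner ℂ (antiPart S v) (linPart S w) = inner ℂ (antiPart S w) (linPart S v) := by
  refine eq_of_im_eq (f := fun w => inner ℂ (antiPart S v) (linPart S w))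
    (g := fun w => inner ℂ (antiPart S w) (linPart S v)) ?_ ?_ ?_ w
  · intro w
    simp only [linPart_I_smul, inner_smul_right]
  · intro w
    simp only [antiPart_I_smul, inner_neg_left, inner_smul_left, Complex.conj_I]
    ring
  · intro w
    have := (hS.im_blocks v w).2
    rw [← inner_conj_symm (linPart S v), Complex.conj_im] at this
    linarith

theorem IsInfSymplectic.im_blocks {ξ : V →L[ℝ] V} (hξ : IsInfSymplectic ξ) (v w : V) :
    (inner ℂ (linPart ξ v) w).im + (inner ℂ v (linPart ξ w)).im = 0 ∧
    (inner ℂ (antiPart ξ v) w).im + (inner ℂ v (antiPart ξ w)).im = 0 := by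
  have h1 := hξ v w
  have h2 := hξ (Complex.I • v) (Complex.I • w)
  simp only [← linPart_add_antiPart ξ, linPart_I_smul, antiPart_I_smul, inner_add_left,
    inner_add_right, inner_neg_left, inner_neg_right, I_smul_inner_I_smul, Complex.add_im,
    Complex.neg_im] at h1 h2
  constructor <;> linarith

theorem IsInfSymplectic.inner_linPart {ξ : V →L[ℝ] V} (hξ : IsInfSymplectic ξ) (v w : V) :
    inner ℂ (linPart ξ v) w = -inner ℂ v (linPart ξ w) := by
  refine eq_of_im_eq (f := fun w => inner ℂ (linPart ξ v) w)
    (g := fun w => -inner ℂ v (linPart ξ w)) ?_ ?_ ?_ w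
  · intro w
    simp only [inner_smul_right]
  · intro w
    simp only [linPart_I_smul, inner_smul_right]
    ring
  · intro w
    have := (hξ.im_blocks v w).1
    rw [Complex.neg_im]
    linarith

theorem IsInfSymplectic.inner_antiPart {ξ : V →L[ℝ] V} (hξ : IsInfSymplectic ξ) (v w : V) :
    inner ℂ (antiPart ξ v) w = inner ℂ (antiPart ξ w) v := by
  refine eq_of_im_eq (f := fun w => inner ℂ (antiPart ξ v) w)
    (g := fun w => inner ℂ (antiPart ξ w) v) ?_ ?_ ?_ w
  · intro w
    simp only [inner_smul_right]
  · intro w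
    simp only [antiPart_I_smul, inner_neg_left, inner_smul_left, Complex.conj_I]
    ring
  · intro w
    have := (hξ.im_blocks v w).2
    rw [← inner_conj_symm v, Complex.conj_im] at this
    linarith

theorem IsSymplectic.norm_linPart_sq {S : V →L[ℝ] V} (hS : IsSymplectic S) (v : V) :
    ‖linPart S v‖ ^ 2 = ‖v‖ ^ 2 + ‖antiPart S v‖ ^ 2 := by
  have h := hS.inner_linPart_sub v v
  simp only [inner_self_eq_norm_sq_to_K] at h
  norm_cast at h
  linarith

/-- The identity |Pv|² = |v|² + |Nv|² makes P injective, and the dimension is finite. -/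
theorem IsSymplectic.isUnit_linPart [FiniteDimensional ℂ V] {S : V →L[ℝ] V}
    (hS : IsSymplectic S) : IsUnit (linPart S) := by
  have : CompleteSpace V := FiniteDimensional.complete ℂ V
  have hinj : Function.Injective (linPart S : V →ₗ[ℝ] V) := by
    rw [← LinearMap.ker_eq_bot, LinearMap.ker_eq_bot']
    intro v hv
    have h := hS.norm_linPart_sq v
    rw [show linPart S v = 0 from hv, norm_zero] at h
    have : ‖v‖ ^ 2 = 0 := by nlinarith [sq_nonneg ‖v‖, sq_nonneg ‖antiPart S v‖]
    simpa using this
  rw [ContinuousLinearMap.isUnit_iff_bijective]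
  exact ⟨hinj, LinearMap.injective_iff_surjective.1 hinj⟩

/-! ### The complexified graph of a symplectic map -/

/-- The vector `y` such that the complexification of `S`, acting on `V^{1,0} ⊕ V^{0,1}`, maps
`(y, z̄)` to a vector whose first component is `z`. -/
noncomputable def graphSource (S : V →L[ℝ] V) (z : V) : V :=
  Ring.inverse (linPart S) (z - antiPart S z)

/-- The vector `x` such that the complexification of `S`, acting on `V^{1,0} ⊕ V^{0,1}`, maps
`(y, z̄)` to `(z, x̄)`, where `y = graphSource S z`. -/
noncomputable def graphTarget (S : V →L[ℝ] V) (z : V) : V :=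
  linPart S z + antiPart S (graphSource S z)

theorem IsSymplectic.linPart_graphSource [FiniteDimensional ℂ V] {S : V →L[ℝ] V}
    (hS : IsSymplectic S) (z : V) :
    linPart S (graphSource S z) = z - antiPart S z := by
  rw [graphSource, ← mul_apply_eq_comp, Ring.mul_inverse_cancel _ hS.isUnit_linPart,
    one_apply_eq_self]

theorem IsSymplectic.injective_linPart {S : V →L[ℝ] V} (hS : IsSymplectic S) {v w : V}
    (h : linPart S v = linPart S w) : v = w := by
  have h1 := hS.norm_linPart_sq (v - w)
  rw [map_sub, h, sub_self, norm_zero] at h1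
  have : ‖v - w‖ ^ 2 = 0 := by nlinarith [sq_nonneg ‖v - w‖, sq_nonneg ‖antiPart S (v - w)‖]
  exact sub_eq_zero.1 (by simpa using this)

theorem IsSymplectic.graphSource_eq [FiniteDimensional ℂ V] {S : V →L[ℝ] V}
    (hS : IsSymplectic S) {z : V} (hz : S z = z) : graphSource S z = z := by
  apply hS.injective_linPart
  rw [hS.linPart_graphSource, sub_eq_iff_eq_add, linPart_add_antiPart, hz]

theorem IsSymplectic.graphTarget_eq [FiniteDimensional ℂ V] {S : V →L[ℝ] V}
    (hS : IsSymplectic S) {z : V} (hz : S z = z) : graphTarget S z = z := by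
  rw [graphTarget, hS.graphSource_eq hz, linPart_add_antiPart, hz]

/-- Invariance of the complexified symplectic form, tested on the graph vectors starting at (y, z̄)
and (v, 0). It later eliminates the derivative of y from that of the phase. -/
theorem IsSymplectic.inner_graphTarget_linPart [FiniteDimensional ℂ V] {S : V →L[ℝ] V}
    (hS : IsSymplectic S) (z v : V) :
    inner ℂ (graphTarget S z) (linPart S v) = inner ℂ (antiPart S v) z + inner ℂ z v := by
  rw [graphTarget, inner_add_left, hS.inner_antiPart_linPart, hS.linPart_graphSource,
    inner_sub_right, ← hS.inner_linPart_sub z v]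
  ring

/-- Expand z = Py + Nz and x = Pz + Ny: the cross terms agree by the mixed block relation, and the
squares cancel through |Pv|² - |Nv|² = |v|². This is what completes the squares in the real part of
the phase. -/
theorem IsSymplectic.norm_graph [FiniteDimensional ℂ V] {S : V →L[ℝ] V}
    (hS : IsSymplectic S) (z : V) :
    ‖graphTarget S z‖ ^ 2 + ‖graphSource S z‖ ^ 2 = 2 * ‖z‖ ^ 2 := by
  have hz : linPart S (graphSource S z) + antiPart S z = z := by
    rw [hS.linPart_graphSource, sub_add_cancel]
  have e1 : ‖z‖ ^ 2 = ‖linPart S (graphSource S z)‖ ^ 2 +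
      2 * (inner ℂ (linPart S (graphSource S z)) (antiPart S z)).re + ‖antiPart S z‖ ^ 2 := by
    conv_lhs => rw [← hz]
    exact norm_add_sq (𝕜 := ℂ) _ _
  have e2 : ‖graphTarget S z‖ ^ 2 = ‖linPart S z‖ ^ 2 +
      2 * (inner ℂ (linPart S z) (antiPart S (graphSource S z))).re +
        ‖antiPart S (graphSource S z)‖ ^ 2 := norm_add_sq (𝕜 := ℂ) _ _
  have e3 : (inner ℂ (linPart S (graphSource S z)) (antiPart S z)).re =
      (inner ℂ (linPart S z) (antiPart S (graphSource S z))).re := by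
    rw [← inner_conj_symm, ← inner_conj_symm (linPart S z), hS.inner_antiPart_linPart]
  have h1 := hS.norm_linPart_sq z
  have h2 := hS.norm_linPart_sq (graphSource S z)
  linarith

/-- The phase of the kernel of the metaplectic quantization of `S` at `(z, z)`. -/
noncomputable def graphPhase (S : V →L[ℝ] V) (z : V) : ℂ :=
  (1 / 2) * (inner ℂ z (graphSource S z) + inner ℂ (graphTarget S z) z) - (‖z‖ : ℂ) ^ 2

theorem IsSymplectic.re_graphPhase [FiniteDimensional ℂ V] {S : V →L[ℝ] V}
    (hS : IsSymplectic S) (z : V) : (graphPhase S z).re =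
      -(1 / 4) * (‖z - graphSource S z‖ ^ 2 + ‖graphTarget S z - z‖ ^ 2) := by
  have h1 : ‖z - graphSource S z‖ ^ 2 = _ := norm_sub_sq (𝕜 := ℂ) z (graphSource S z)
  have h2 : ‖graphTarget S z - z‖ ^ 2 = _ := norm_sub_sq (𝕜 := ℂ) (graphTarget S z) z
  have h3 := hS.norm_graph z
  have h4 : (graphPhase S z).re =
      (1 / 2) * ((inner ℂ z (graphSource S z)).re + (inner ℂ (graphTarget S z) z).re)
        - ‖z‖ ^ 2 := by
    rw [graphPhase, Complex.sub_re, ← Complex.ofReal_pow, Complex.ofReal_re,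
      ← Complex.add_re]
    norm_num
  simp only [RCLike.re_to_complex] at h1 h2
  rw [h1, h2, h4]
  linarith

theorem IsSymplectic.re_graphPhase_neg [FiniteDimensional ℂ V] {S : V →L[ℝ] V}
    (hS : IsSymplectic S) {z : V} (hz : S z ≠ z) : (graphPhase S z).re < 0 := by
  rw [hS.re_graphPhase]
  have h1 : 0 < ‖z - graphSource S z‖ ^ 2 := by
    have : z - graphSource S z ≠ 0 := by
      intro h
      apply hz
      -- If y = z, then Pz = z - Nz, that is, Sz = z.
      have h2 := hS.linPart_graphSource z
      rw [← sub_eq_zero.1 h, eq_sub_iff_add_eq, linPart_add_antiPart] at h2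
      exact h2
    positivity
  nlinarith [sq_nonneg ‖graphTarget S z - z‖]

theorem IsSymplectic.graphPhase_eq_zero [FiniteDimensional ℂ V] {S : V →L[ℝ] V}
    (hS : IsSymplectic S) {z : V} (hz : S z = z) : graphPhase S z = 0 := by
  rw [graphPhase, hS.graphSource_eq hz, hS.graphTarget_eq hz, inner_self_eq_norm_sq_to_K]
  simp only [Complex.coe_algebraMap]
  ring

/-- If `S α = α`, then `Re ⟪α, P⁻¹ α⟫ > 0`. -/
theorem IsSymplectic.re_inner_pos {S : V →L[ℝ] V} (hS : IsSymplectic S) {α v : V} (hα : S α = α)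
    (hα0 : α ≠ 0) (hv : linPart S v = α) :
    inner ℂ α v = inner ℂ α α - inner ℂ (antiPart S v) α ∧ 0 < (inner ℂ α v).re := by
  have key : inner ℂ α v = inner ℂ α α - inner ℂ (antiPart S v) α := by
    have h1 := hS.inner_linPart_sub α v
    have h2 := hS.inner_antiPart_linPart α v
    have h3 : inner ℂ α (linPart S v) =
        inner ℂ (linPart S α) (linPart S v) + inner ℂ (antiPart S α) (linPart S v) := by
      rw [← inner_add_left, linPart_add_antiPart, hα]
    have h4 : inner ℂ (antiPart S v) α =
        inner ℂ (antiPart S v) (linPart S α) + inner ℂ (antiPart S v) (antiPart S α) := by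
      rw [← inner_add_right, linPart_add_antiPart, hα]
    rw [hv] at h1 h2 h3
    linear_combination -h1 - h3 + h4 - h2
  refine ⟨key, ?_⟩
  have hv0 : v ≠ 0 := by
    rintro rfl
    exact hα0 (by rw [← hv, map_zero])
  have hn := hS.norm_linPart_sq v
  rw [hv] at hn
  have hvpos : 0 < ‖v‖ ^ 2 := by positivity
  have hlt : ‖antiPart S v‖ < ‖α‖ := lt_of_pow_lt_pow_left₀ 2 (norm_nonneg _) (by linarith)
  have hαpos : 0 < ‖α‖ := norm_pos_iff.2 hα0
  have hle : (inner ℂ (antiPart S v) α).re ≤ ‖antiPart S v‖ * ‖α‖ :=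
    (Complex.re_le_norm _).trans (norm_inner_le_norm _ _)
  have hαα : (inner ℂ α α).re = ‖α‖ ^ 2 := by
    rw [inner_self_eq_norm_sq_to_K]; norm_cast
  rw [key, Complex.sub_re, hαα]
  nlinarith

end Blocks

end BargmannFock

namespace BargmannFock

section Kernel

variable {V : Type*} [NormedAddCommGroup V] [InnerProductSpace ℂ V]

attribute [local instance] InnerProductSpace.complexToReal

/-! ### The kernel of the metaplectic quantization of a symplectic map -/

theorem real_inner_eq (v w : V) : inner ℝ v w = (inner ℂ v w).re := rfl

theorem re_inner_neg_I_smul (v w : V) :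
    (inner ℂ (-(Complex.I • v)) w).re = -(inner ℂ v w).im := by
  rw [inner_neg_left, inner_smul_left, Complex.conj_I]
  simp

/-- P - N = -iSi is the inverse transpose of S for the real inner product. -/
theorem IsSymplectic.re_inner_conj {S : V →L[ℝ] V} (hS : IsSymplectic S) (v w : V) :
    (inner ℂ (linPart S v - antiPart S v) (S w)).re = (inner ℂ v w).re := by
  have e : linPart S v - antiPart S v = -(Complex.I • S (Complex.I • v)) := by
    rw [linPart_apply, antiPart_apply]
    module
  rw [e, re_inner_neg_I_smul, hS, inner_smul_left, Complex.conj_I]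
  simp

theorem IsSymplectic.re_inner_linPart {S : V →L[ℝ] V} (hS : IsSymplectic S) (v w : V) :
    (inner ℂ (linPart S v) (S w)).re = (1 / 2) * ((inner ℂ (S v) (S w)).re + (inner ℂ v w).re) := by
  rw [← hS.re_inner_conj v w, ← Complex.add_re, ← inner_add_left, ← linPart_add_antiPart S v,
    show linPart S v + antiPart S v + (linPart S v - antiPart S v) = (2 : ℝ) • linPart S v by
      module, real_smul_eq, inner_smul_left, Complex.conj_ofReal, Complex.re_ofReal_mul]
  ring

/-- The real symmetric operator `Sᵀ P = (Sᵀ S + 1) / 2`, where `Sᵀ = -J S⁻¹ J`; here `R` is the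
inverse of `S`. -/
noncomputable def gaussForm (S R : V →L[ℝ] V) : V →L[ℝ] V :=
  -(mulI V * R * mulI V) * linPart S

theorem IsSymplectic.inner_gaussForm {S R : V →L[ℝ] V} (hS : IsSymplectic S)
    (hR : ∀ v, S (R v) = v) (v w : V) :
    inner ℝ (gaussForm S R v) w = (inner ℂ (linPart S v) (S w)).re := by
  change (inner ℂ (-(Complex.I • R (Complex.I • linPart S v))) w).re = _
  rw [re_inner_neg_I_smul, ← hS, hR, inner_smul_left, Complex.conj_I]
  simp

theorem IsSymplectic.gaussForm_isSymmetric {S R : V →L[ℝ] V} (hS : IsSymplectic S)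
    (hR : ∀ v, S (R v) = v) : (gaussForm S R : V →ₗ[ℝ] V).IsSymmetric := by
  intro v w
  change inner ℝ (gaussForm S R v) w = inner ℝ v (gaussForm S R w)
  rw [real_inner_comm (gaussForm S R w), hS.inner_gaussForm hR, hS.inner_gaussForm hR,
    hS.re_inner_linPart, hS.re_inner_linPart, ← inner_conj_symm (S v), ← inner_conj_symm v,
    Complex.conj_re, Complex.conj_re]

theorem IsSymplectic.inner_gaussForm_self {S R : V →L[ℝ] V} (hS : IsSymplectic S)
    (hR : ∀ v, S (R v) = v) (v : V) :
    inner ℝ (gaussForm S R v) v = (1 / 2) * (‖S v‖ ^ 2 + ‖v‖ ^ 2) := by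
  have h : ∀ x : V, (inner ℂ x x).re = ‖x‖ ^ 2 := by
    intro x
    rw [inner_self_eq_norm_sq_to_K]; norm_cast
  rw [hS.inner_gaussForm hR, hS.re_inner_linPart, h, h]

theorem IsSymplectic.inner_gaussForm_pos {S R : V →L[ℝ] V} (hS : IsSymplectic S)
    (hR : ∀ v, S (R v) = v) {v : V} (hv : v ≠ 0) : 0 < inner ℝ (gaussForm S R v) v := by
  rw [hS.inner_gaussForm_self hR]
  have : 0 < ‖v‖ ^ 2 := by positivity
  nlinarith [sq_nonneg ‖S v‖]

theorem det_nonneg_of_isSymmetric {W : Type*} [NormedAddCommGroup W] [InnerProductSpace ℝ W]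
    [FiniteDimensional ℝ W] {M : W →ₗ[ℝ] W} (hM : M.IsSymmetric)
    (hpos : ∀ u, u ≠ 0 → 0 < inner ℝ (M u) u) : 0 ≤ LinearMap.det M := by
  rw [hM.det_eq_prod_eigenvalues rfl]
  refine Finset.prod_nonneg fun i _ => ?_
  have h1 := hpos _ ((hM.eigenvectorBasis rfl).orthonormal.ne_zero i)
  rw [hM.apply_eigenvectorBasis] at h1
  simp only [RCLike.ofReal_real_eq_id, id_eq, real_inner_smul_left, real_inner_self_eq_norm_sq,
    (hM.eigenvectorBasis rfl).orthonormal.1 i, one_pow, mul_one] at h1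
  exact h1.le

/-- The exponent of the integrand of the kernel, up to the quadratic term. -/
noncomputable def kernelLinear (S : V →L[ℝ] V) (z : V) : V →ₗ[ℝ] ℂ where
  toFun u := inner ℂ (S u) z + inner ℂ z u
  map_add' u v := by
    rw [map_add, inner_add_left, inner_add_right]; ring
  map_smul' r u := by
    rw [map_smul, real_smul_eq, real_smul_eq, inner_smul_left, inner_smul_right,
      Complex.conj_ofReal, RingHom.id_apply, Complex.real_smul]
    ring

theorem kernelLinear_apply (S : V →L[ℝ] V) (z u : V) :
    kernelLinear S z u = inner ℂ (S u) z + inner ℂ z u := rfl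

variable [FiniteDimensional ℂ V]

theorem det_adjoint_real {W : Type*} [NormedAddCommGroup W] [InnerProductSpace ℝ W]
    [FiniteDimensional ℝ W] (A : W →ₗ[ℝ] W) : LinearMap.det A.adjoint = LinearMap.det A := by
  rw [← LinearMap.det_toMatrix (stdOrthonormalBasis ℝ W).toBasis, LinearMap.toMatrix_adjoint,
    Matrix.det_conjTranspose, LinearMap.det_toMatrix, star_trivial]

/-- The transpose of S is -iRi with R the inverse of S, so det S = det R, while det S · det R = 1.
The sign is not needed below, where positivity of the form fixes it. -/
theorem IsSymplectic.abs_det {S R : V →L[ℝ] V} (hS : IsSymplectic S)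
    (hR : ∀ v, S (R v) = v) : |LinearMap.det (R : V →ₗ[ℝ] V)| = 1 := by
  have hJJ : LinearMap.det (mulI V : V →ₗ[ℝ] V) * LinearMap.det (mulI V : V →ₗ[ℝ] V) =
      LinearMap.det (-1 : V →ₗ[ℝ] V) := by
    rw [← map_mul]
    congr 1
    ext v
    exact I_smul_I_smul v
  have hneg : LinearMap.det (-1 : V →ₗ[ℝ] V) * LinearMap.det (-1 : V →ₗ[ℝ] V) = 1 := by
    rw [← map_mul]; simp
  have hadj : (S : V →ₗ[ℝ] V).adjoint =
      (-1) * (mulI V : V →ₗ[ℝ] V) * (R : V →ₗ[ℝ] V) * (mulI V : V →ₗ[ℝ] V) := by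
    symm
    rw [LinearMap.eq_adjoint_iff]
    intro v w
    change inner ℝ (-(Complex.I • R (Complex.I • v))) w = inner ℝ v (S w)
    rw [real_inner_eq, real_inner_eq, re_inner_neg_I_smul, ← hS, hR, inner_smul_left,
      Complex.conj_I]
    simp
  have h1 := det_adjoint_real (S : V →ₗ[ℝ] V)
  rw [hadj, map_mul, map_mul, map_mul] at h1
  have h2 : LinearMap.det (S : V →ₗ[ℝ] V) * LinearMap.det (R : V →ₗ[ℝ] V) = 1 := by
    rw [← map_mul]
    have : (S : V →ₗ[ℝ] V) * (R : V →ₗ[ℝ] V) = 1 := by ext v; exact hR v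
    rw [this, map_one]
  have h3 : LinearMap.det (R : V →ₗ[ℝ] V) ^ 2 = 1 := by
    rw [← h2, ← h1]
    linear_combination (-LinearMap.det (R : V →ₗ[ℝ] V) ^ 2) * LinearMap.det (-1 : V →ₗ[ℝ] V) * hJJ
      - (LinearMap.det (R : V →ₗ[ℝ] V) ^ 2) * hneg
  rw [← sq_abs] at h3
  exact (pow_eq_one_iff_of_nonneg (abs_nonneg _) two_ne_zero).1 h3

theorem IsSymplectic.det_gaussForm {S R : V →L[ℝ] V} (hS : IsSymplectic S)
    (hR : ∀ v, S (R v) = v) :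
    LinearMap.det (gaussForm S R : V →ₗ[ℝ] V) = ‖LinearMap.det (holBlock S)‖ ^ 2 := by
  have hnn := det_nonneg_of_isSymmetric (hS.gaussForm_isSymmetric hR)
    fun u hu => hS.inner_gaussForm_pos hR hu
  have hP : LinearMap.det (linPart S : V →ₗ[ℝ] V) = ‖LinearMap.det (holBlock S)‖ ^ 2 := by
    have : (linPart S : V →ₗ[ℝ] V) = (holBlock S).restrictScalars ℝ := by
      ext v; exact (holBlock_apply S v).symm
    rw [this, LinearMap.det_restrictScalars, Algebra.norm_complex_apply, Complex.normSq_eq_norm_sq]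
  have hprod : (gaussForm S R : V →ₗ[ℝ] V) = (-1) * (mulI V : V →ₗ[ℝ] V) * (R : V →ₗ[ℝ] V) *
      (mulI V : V →ₗ[ℝ] V) * (linPart S : V →ₗ[ℝ] V) := by
    ext v
    rfl
  have hJJ : (-1) * (mulI V : V →ₗ[ℝ] V) * (mulI V : V →ₗ[ℝ] V) = 1 := by
    ext v
    change -(Complex.I • Complex.I • v) = v
    rw [I_smul_I_smul, neg_neg]
  have hdJ := congrArg LinearMap.det hJJ
  rw [map_mul, map_mul, map_one] at hdJ
  rw [← abs_of_nonneg hnn, hprod, map_mul, map_mul, map_mul, map_mul, hP,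
    show ∀ a b c d : ℝ, a * b * c * b * d = (a * b * b) * (c * d) by intro a b c d; ring, hdJ, one_mul,
    abs_mul, hS.abs_det hR, one_mul, abs_of_nonneg (by positivity)]

/-- With the companion for the imaginary part, this identifies the complex critical point of the
Gaussian as half of (z + y) + √-1 ⊗ i(z - y) in the complexification of V. -/
theorem IsSymplectic.re_kernelLinear {S R : V →L[ℝ] V} (hS : IsSymplectic S)
    (hR : ∀ v, S (R v) = v) (z u : V) :
    (kernelLinear S z u).re = inner ℝ (gaussForm S R (z + graphSource S z)) u := by
  rw [hS.inner_gaussForm hR, map_add, hS.linPart_graphSource,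
    show linPart S z + (z - antiPart S z) = z + (linPart S z - antiPart S z) by abel,
    inner_add_left, Complex.add_re, hS.re_inner_conj, kernelLinear_apply, Complex.add_re,
    ← inner_conj_symm (S u), Complex.conj_re]

theorem IsSymplectic.im_kernelLinear {S R : V →L[ℝ] V} (hS : IsSymplectic S)
    (hR : ∀ v, S (R v) = v) (z u : V) :
    (kernelLinear S z u).im =
      inner ℝ (gaussForm S R (Complex.I • (z - graphSource S z))) u := by
  rw [hS.inner_gaussForm hR, linPart_I_smul, map_sub, hS.linPart_graphSource,
    show linPart S z - (z - antiPart S z) = linPart S z + antiPart S z - z by abel,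
    linPart_add_antiPart, inner_smul_left, inner_sub_left, kernelLinear_apply, Complex.add_im,
    ← inner_conj_symm (S u), Complex.conj_im, ← hS z u, Complex.conj_I]
  simp
  ring

theorem IsSymplectic.kernelLinear_graph {S : V →L[ℝ] V} (hS : IsSymplectic S) (z : V) :
    kernelLinear S z (z + graphSource S z) +
      Complex.I * kernelLinear S z (Complex.I • (z - graphSource S z)) =
    4 * (graphPhase S z + (‖z‖ : ℂ) ^ 2) := by
  have e1 : S (z + graphSource S z) = z + graphTarget S z := by
    rw [map_add, ← linPart_add_antiPart S z, ← linPart_add_antiPart S (graphSource S z),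
      hS.linPart_graphSource, graphTarget]
    abel
  have e2 : S (Complex.I • (z - graphSource S z)) = Complex.I • (graphTarget S z - z) := by
    rw [← linPart_add_antiPart S, linPart_I_smul, antiPart_I_smul, map_sub, map_sub,
      hS.linPart_graphSource, graphTarget, ← smul_neg, ← smul_add]
    congr 1
    abel
  rw [kernelLinear_apply, kernelLinear_apply, e1, e2, graphPhase]
  simp only [inner_add_left, inner_add_right, inner_smul_left, inner_smul_right, inner_sub_left,
    inner_sub_right, Complex.conj_I]
  linear_combination (inner ℂ z z - inner ℂ (graphTarget S z) z + inner ℂ z z -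
    inner ℂ z (graphSource S z)) * Complex.I_mul_I

variable [MeasurableSpace V] [BorelSpace V]

theorem IsSymplectic.integral_bergman {S R : V →L[ℝ] V} (hS : IsSymplectic S)
    (hR : ∀ v, S (R v) = v) (z : V) {k : ℕ} (hk : 0 < k) :
    ∫ u, bergman k z (S u) * bergman k u z ∂(liouville V) =
      ((k : ℂ) / (2 * π)) ^ Module.finrank ℂ V * (‖LinearMap.det (holBlock S)‖ : ℂ)⁻¹ *
        Complex.exp (k * graphPhase S z) := by
  set m := Module.finrank ℂ V with hm
  have hk' : (0 : ℝ) < k := by exact_mod_cast hk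
  have hint : ∀ u, bergman k z (S u) * bergman k u z =
      (((k : ℂ) / (2 * π)) ^ m * ((k : ℂ) / (2 * π)) ^ m * Complex.exp (-(k * (‖z‖ : ℂ) ^ 2))) *
        Complex.exp ((k : ℝ) * (-(inner ℝ ((gaussForm S R : V →ₗ[ℝ] V) u) u : ℝ) +
          kernelLinear S z u)) := by
    intro u
    have : inner ℝ ((gaussForm S R : V →ₗ[ℝ] V) u) u = (1 / 2) * (‖S u‖ ^ 2 + ‖u‖ ^ 2) :=
      hS.inner_gaussForm_self hR u
    rw [this, kernelLinear_apply, bergman, bergman, mul_mul_mul_comm, ← Complex.exp_add,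
      mul_assoc (_ * _), ← Complex.exp_add]
    congr 2
    push_cast
    ring
  simp only [hint]
  rw [integral_const_mul, liouville_eq, integral_smul_measure,
    integral_cexp_neg_quadratic_add_linear (hS.gaussForm_isSymmetric hR)
      (fun u hu => hS.inner_gaussForm_pos hR hu) (kernelLinear S z)
      (a := z + graphSource S z) (b := Complex.I • (z - graphSource S z))
      (fun u => hS.re_kernelLinear hR z u) (fun u => hS.im_kernelLinear hR z u) hk',
    hS.kernelLinear_graph, hS.det_gaussForm hR, finrank_real_eq, ← hm, pow_mul', ← div_pow,
    Real.sqrt_sq (by positivity)]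
  have hexp : Complex.exp (k * graphPhase S z) = Complex.exp (-(k * (‖z‖ : ℂ) ^ 2)) *
      Complex.exp ((k : ℝ) / 4 * (4 * (graphPhase S z + (‖z‖ : ℂ) ^ 2))) := by
    rw [← Complex.exp_add]
    congr 1
    push_cast
    ring
  rw [hexp]
  -- One of the two Bergman prefactors cancels the Liouville factor 2^m and the Gaussian volume
  -- (π/k)^m.
  have hconst : ((k : ℂ) / (2 * π)) ^ m * (2 ^ m * (π / k) ^ m) = 1 := by
    rw [← mul_pow, ← mul_pow]
    have : (k : ℂ) ≠ 0 := by exact_mod_cast hk.ne'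
    have : (π : ℂ) ≠ 0 := by exact_mod_cast Real.pi_ne_zero
    field_simp
    simp
  simp only [ENNReal.toReal_pow, ENNReal.toReal_ofNat, Complex.real_smul]
  push_cast
  linear_combination ((k : ℂ) / (2 * π)) ^ m * Complex.exp (-(k * (‖z‖ : ℂ) ^ 2)) *
    Complex.exp ((k : ℂ) / 4 * (4 * (graphPhase S z + (‖z‖ : ℂ) ^ 2))) *
    (‖LinearMap.det (holBlock S)‖ : ℂ)⁻¹ * hconst

end Kernel

end BargmannFock

namespace BargmannFock

section Flow

variable {V : Type*} [NormedAddCommGroup V] [InnerProductSpace ℂ V] [FiniteDimensional ℂ V]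
  (H : QuadraticForm ℝ V)

/-! ### The Hamilton flow and its contact lift -/

theorem isSymplectic_hamFlow (t : ℝ) : IsSymplectic (hamFlow H t) := by
  intro v w
  have h := omega_hamFlow H t v w
  simpa [omega] using h

theorem isInfSymplectic_hamField : IsInfSymplectic (hamField H) := by
  intro v w
  have h1 := omega_hamField H v w
  have h2 := omega_hamField H w v
  rw [QuadraticMap.polar_comm, omega] at h2
  rw [omega] at h1
  rw [← inner_conj_symm v, Complex.conj_im]
  linarith

theorem commute_hamField_hamFlow (t : ℝ) : Commute (hamField H) (hamFlow H t) := by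
  have : CompleteSpace V := FiniteDimensional.complete ℂ V
  exact ((Commute.refl (hamField H)).smul_right t).exp_right

theorem hamField_hamFlow (t : ℝ) (z : V) :
    hamField H (hamFlow H t z) = hamFlow H t (hamField H z) :=
  congrArg (fun A : V →L[ℝ] V => A z) (commute_hamField_hamFlow H t).eq

theorem hamFlow_add (s t : ℝ) (z : V) : hamFlow H (s + t) z = hamFlow H s (hamFlow H t z) := by
  have : CompleteSpace V := FiniteDimensional.complete ℂ V
  let _ : NormedAlgebra ℚ (V →L[ℝ] V) := NormedAlgebra.restrictScalars ℚ ℝ _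
  have hc : Commute (s • hamField H) (t • hamField H) :=
    ((Commute.refl (hamField H)).smul_right t).smul_left s
  have h : hamFlow H (s + t) = hamFlow H s * hamFlow H t := by
    rw [hamFlow, add_smul, NormedSpace.exp_add_of_commute hc]
    rfl
  rw [h, mul_apply_eq_comp]

theorem hamFlow_hamFlow_neg (t : ℝ) (z : V) : hamFlow H t (hamFlow H (-t) z) = z := by
  rw [← hamFlow_add, add_neg_cancel, hamFlow_zero]

/-- Euler's identity for a form of degree two: the polar form at (z, z) is 2H(z), and the 2 cancels
the one in ω. -/
theorem im_inner_hamField (z : V) : (inner ℂ z (hamField H z)).im = -H z := by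
  have h := omega_hamField H z z
  rw [QuadraticMap.polar_self, omega, ← inner_conj_symm, Complex.conj_im] at h
  simp only [nsmul_eq_mul] at h
  push_cast at h
  linarith

theorem apply_hamFlow (t : ℝ) (z : V) : H (hamFlow H t z) = H z := by
  have h1 := im_inner_hamField H (hamFlow H t z)
  have h2 := im_inner_hamField H z
  rw [hamField_hamFlow, isSymplectic_hamFlow H t] at h1
  linarith

theorem holonomyAngle_eq (z : V) (t : ℝ) : holonomyAngle H z t = t * H z := by
  simp only [holonomyAngle, im_inner_hamField, apply_hamFlow]
  simp

theorem contactAngle_eq_zero (z : V) (t : ℝ) : contactAngle H z t = 0 := by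
  rw [contactAngle, holonomyAngle_eq, sub_self]

theorem detRoot_ne_zero (t : ℝ) : detRoot H t ≠ 0 := Complex.exp_ne_zero _

theorem propagator_self [MeasurableSpace V] [BorelSpace V] {k : ℕ} (hk : 0 < k) (t : ℝ) (z : V) :
    propagator H k t z z = ((k : ℂ) / (2 * π)) ^ Module.finrank ℂ V * (detRoot H t)⁻¹ *
      Complex.exp (k * graphPhase (hamFlow H t) z) := by
  have hi := (isSymplectic_hamFlow H t).integral_bergman (hamFlow_hamFlow_neg H t) z hk
  simp only [propagator, contactAngle_eq_zero, Complex.ofReal_zero, mul_zero, neg_zero,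
    Complex.exp_zero, mul_one]
  rw [hi]
  -- With r the root, |det P| = |r|² = r̄ r. This is where the metaplectic factor η_t = r̄ converts
  -- a modulus into the continuous branch.
  have hr : (starRingEnd ℂ) (detRoot H t) * (‖LinearMap.det (holBlock (hamFlow H t))‖ : ℂ)⁻¹ =
      (detRoot H t)⁻¹ := by
    have h1 : ‖LinearMap.det (holBlock (hamFlow H t))‖ = ‖detRoot H t‖ ^ 2 := by
      rw [← norm_pow, detRoot_sq]; rfl
    have h2 := detRoot_ne_zero H t
    have h3 := Complex.conj_mul' (detRoot H t)
    rw [h1, Complex.ofReal_pow, ← h3, mul_inv, mul_inv_cancel_left₀]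
    exact (map_ne_zero _).2 h2
  rw [← hr]
  ring

/-! ### The phase along the flow -/

theorem contDiff_hamFlow {n : WithTop ℕ∞} : ContDiff ℝ n fun t : ℝ => hamFlow H t := by
  have : CompleteSpace V := FiniteDimensional.complete ℂ V
  have h : ContDiff ℝ n (NormedSpace.exp : (V →L[ℝ] V) → (V →L[ℝ] V)) :=
    contDiff_iff_contDiffAt.2 fun x => (NormedSpace.exp_analytic (𝕂 := ℝ) x).contDiffAt
  exact h.comp (contDiff_id.smul contDiff_const)

theorem contDiff_linPart_hamFlow {n : WithTop ℕ∞} :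
    ContDiff ℝ n fun t : ℝ => linPart (hamFlow H t) :=
  ((contDiff_hamFlow H).sub
    ((contDiff_const.mul (contDiff_hamFlow H)).mul contDiff_const)).const_smul (1 / 2 : ℝ)

theorem contDiff_antiPart_hamFlow {n : WithTop ℕ∞} :
    ContDiff ℝ n fun t : ℝ => antiPart (hamFlow H t) :=
  ((contDiff_hamFlow H).add
    ((contDiff_const.mul (contDiff_hamFlow H)).mul contDiff_const)).const_smul (1 / 2 : ℝ)

theorem contDiff_graphSource {n : WithTop ℕ∞} (z : V) :
    ContDiff ℝ n fun t : ℝ => graphSource (hamFlow H t) z := by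
  have : CompleteSpace V := FiniteDimensional.complete ℂ V
  have hinv : ContDiff ℝ n fun t : ℝ => Ring.inverse (linPart (hamFlow H t)) := by
    refine contDiff_iff_contDiffAt.2 fun t => ?_
    obtain ⟨u, hu⟩ := (isSymplectic_hamFlow H t).isUnit_linPart
    have h := contDiffAt_ringInverse (n := n) ℝ u
    rw [hu] at h
    exact h.comp t (contDiff_linPart_hamFlow H).contDiffAt
  exact hinv.clm_apply (contDiff_const.sub ((contDiff_antiPart_hamFlow H).clm_apply contDiff_const))

theorem contDiff_graphTarget {n : WithTop ℕ∞} (z : V) :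
    ContDiff ℝ n fun t : ℝ => graphTarget (hamFlow H t) z :=
  ((contDiff_linPart_hamFlow H).clm_apply contDiff_const).add
    ((contDiff_antiPart_hamFlow H).clm_apply (contDiff_graphSource H z))

theorem contDiff_graphPhase {n : WithTop ℕ∞} (z : V) :
    ContDiff ℝ n fun t : ℝ => graphPhase (hamFlow H t) z :=
  (contDiff_const.mul ((contDiff_const.inner ℂ (contDiff_graphSource H z)).add
    ((contDiff_graphTarget H z).inner ℂ contDiff_const))).sub contDiff_const

theorem hasDerivAt_hamFlow' (t : ℝ) :
    HasDerivAt (fun s => hamFlow H s) (hamField H * hamFlow H t) t := by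
  have : CompleteSpace V := FiniteDimensional.complete ℂ V
  exact hasDerivAt_exp_smul_const' (𝕂 := ℝ) (hamField H) t

theorem hasDerivAt_linPart_hamFlow (t : ℝ) :
    HasDerivAt (fun s => linPart (hamFlow H s)) (linPart (hamField H * hamFlow H t)) t := by
  have h := hasDerivAt_hamFlow' H t
  exact (h.sub ((h.const_mul (mulI V)).mul_const (mulI V))).const_smul (1 / 2 : ℝ)

theorem hasDerivAt_antiPart_hamFlow (t : ℝ) :
    HasDerivAt (fun s => antiPart (hamFlow H s)) (antiPart (hamField H * hamFlow H t)) t := by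
  have h := hasDerivAt_hamFlow' H t
  exact (h.add ((h.const_mul (mulI V)).mul_const (mulI V))).const_smul (1 / 2 : ℝ)

/-- The derivatives of the two components of the complexified graph along the flow. -/
theorem hasDerivAt_graph (z : V) (t : ℝ) : ∃ y' : V,
    linPart (hamFlow H t) y' =
      -(linPart (hamField H) z + antiPart (hamField H) (graphTarget (hamFlow H t) z)) ∧
    HasDerivAt (fun s => graphSource (hamFlow H s) z) y' t ∧
    HasDerivAt (fun s => graphTarget (hamFlow H s) z)
      (linPart (hamField H) (graphTarget (hamFlow H t) z) + antiPart (hamField H) z +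
        antiPart (hamFlow H t) y') t := by
  have hy : HasDerivAt (fun s => graphSource (hamFlow H s) z) _ t :=
    ((contDiff_graphSource H (n := 1) z).differentiable one_ne_zero t).hasDerivAt
  set y' := deriv (fun s => graphSource (hamFlow H s) z) t with hy'
  have hP := hasDerivAt_linPart_hamFlow H t
  have hN := hasDerivAt_antiPart_hamFlow H t
  have hyeq := fun s => (isSymplectic_hamFlow H s).linPart_graphSource z
  refine ⟨y', ?_, hy, ?_⟩
  -- Differentiate P y = z - N z, using P' = ξ₁P + ξ₂N and N' = ξ₁N + ξ₂P, where ξ₁ and ξ₂ are the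
  -- blocks of ξ.
  · have h1 := hP.clm_apply hy
    have h2 : HasDerivAt (fun s => linPart (hamFlow H s) (graphSource (hamFlow H s) z))
        (0 - antiPart (hamField H * hamFlow H t) z) t := by
      simp only [hyeq]
      refine ((hasDerivAt_const t z).sub (hN.clm_apply (hasDerivAt_const t z))).congr_deriv ?_
      rw [map_zero, add_zero]
    have h3 := h1.unique h2
    rw [linPart_comp, antiPart_comp, hyeq] at h3
    rw [graphTarget, map_add]
    rw [map_sub, zero_sub] at h3
    have h4 := eq_sub_of_add_eq' h3
    rw [h4]
    abel
  · have h1 := (hP.clm_apply (hasDerivAt_const t z)).add (hN.clm_apply hy)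
    refine h1.congr_deriv ?_
    rw [linPart_comp, antiPart_comp, hyeq, graphTarget, map_zero, map_add, map_sub]
    abel

/-- The terms containing y' add up to ⟨x, Py'⟩, and Py' is known; the result depends on t only
through x, so it can be differentiated again easily. -/
theorem hasDerivAt_graphPhase (z : V) (t : ℝ) :
    HasDerivAt (fun s => graphPhase (hamFlow H s) z)
      ((1 / 2) * (inner ℂ (antiPart (hamField H) z) z -
        inner ℂ (graphTarget (hamFlow H t) z)
          (antiPart (hamField H) (graphTarget (hamFlow H t) z))) -
        inner ℂ (graphTarget (hamFlow H t) z) (linPart (hamField H) z)) t := by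
  obtain ⟨y', hy', hy, hx⟩ := hasDerivAt_graph H z t
  have h := ((((hasDerivAt_const t z).inner ℂ hy).add (hx.inner ℂ (hasDerivAt_const t z))).const_mul
    (1 / 2 : ℂ)).sub_const ((‖z‖ : ℂ) ^ 2)
  have hS := isSymplectic_hamFlow H t
  have hξ := isInfSymplectic_hamField H
  have h1 := hS.inner_graphTarget_linPart z y'
  rw [hy'] at h1
  refine h.congr_deriv ?_
  simp only [inner_zero_left, inner_zero_right, inner_add_left, add_zero, zero_add, hξ.inner_linPart]
  simp only [inner_neg_right, inner_add_right] at h1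
  linear_combination (-1 / 2 : ℂ) * h1

theorem hasDerivAt_deriv_graphPhase {z : V} {t : ℝ} (hz : hamFlow H t z = z) {v : V}
    (hv : linPart (hamFlow H t) v = hamField H z) :
    deriv (fun s => graphPhase (hamFlow H s) z) t = Complex.I * H z ∧
    HasDerivAt (deriv fun s => graphPhase (hamFlow H s) z) (-inner ℂ (hamField H z) v) t := by
  have hS := isSymplectic_hamFlow H t
  have hξ := isInfSymplectic_hamField H
  have hx0 : graphTarget (hamFlow H t) z = z := hS.graphTarget_eq hz
  have hd : deriv (fun s => graphPhase (hamFlow H s) z) = fun t => (1 / 2) *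
      (inner ℂ (antiPart (hamField H) z) z - inner ℂ (graphTarget (hamFlow H t) z)
          (antiPart (hamField H) (graphTarget (hamFlow H t) z))) -
        inner ℂ (graphTarget (hamFlow H t) z) (linPart (hamField H) z) :=
    funext fun t => (hasDerivAt_graphPhase H z t).deriv
  constructor
  · rw [hd]
    simp only [hx0]
    have h1 := im_inner_hamField H z
    have h2 := hξ.inner_linPart z z
    rw [← linPart_add_antiPart, inner_add_right, Complex.add_im] at h1
    rw [← inner_conj_symm] at h2
    have h3 := congrArg Complex.re h2
    rw [Complex.conj_re, Complex.neg_re] at h3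
    have h4 : (inner ℂ (antiPart (hamField H) z) z).re =
        (inner ℂ z (antiPart (hamField H) z)).re := by rw [← inner_conj_symm, Complex.conj_re]
    have h5 : (inner ℂ (antiPart (hamField H) z) z).im =
        -(inner ℂ z (antiPart (hamField H) z)).im := by rw [← inner_conj_symm, Complex.conj_im]
    apply Complex.ext
    · simp
      linarith
    · simp
      linarith
  · obtain ⟨y', hy', hy, hx⟩ := hasDerivAt_graph H z t
    rw [hx0] at hx hy'
    rw [linPart_add_antiPart] at hx hy'
    have hyv : y' = -v := by
      apply hS.injective_linPart
      rw [hy', map_neg, hv]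
    have hY : HasDerivAt (fun s => antiPart (hamField H) (graphTarget (hamFlow H s) z))
        (antiPart (hamField H) (hamField H z + antiPart (hamFlow H t) y')) t :=
      (antiPart (hamField H)).hasFDerivAt.comp_hasDerivAt t hx
    have h := ((((hx.inner ℂ hY).const_sub (inner ℂ (antiPart (hamField H) z) z)).const_mul
      (1 / 2 : ℂ)).sub (hx.inner ℂ (hasDerivAt_const t (linPart (hamField H) z))))
    rw [hd]
    refine h.congr_deriv ?_
    have hfix : hamFlow H t (hamField H z) = hamField H z := by rw [← hamField_hamFlow, hz]
    -- The derivative of x at a return time is α - Nv, and ⟨α, v⟩ = ⟨α - Nv, α⟩ because α is fixed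
    -- by the flow map.
    have hα : inner ℂ (hamField H z) v =
        inner ℂ (hamField H z + antiPart (hamFlow H t) y') (hamField H z) := by
      by_cases h0 : hamField H z = 0
      · simp [h0]
      · rw [(hS.re_inner_pos hfix h0 hv).1, hyv, map_neg, inner_add_left, inner_neg_left]
        ring
    have hsymm : inner ℂ z (antiPart (hamField H) (hamField H z + antiPart (hamFlow H t) y')) =
        inner ℂ (hamField H z + antiPart (hamFlow H t) y') (antiPart (hamField H) z) := by
      rw [← inner_conj_symm, hξ.inner_antiPart, inner_conj_symm]
    rw [hx0, hsymm, hα, inner_zero_right]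
    have : inner ℂ (hamField H z + antiPart (hamFlow H t) y') (hamField H z) =
        inner ℂ (hamField H z + antiPart (hamFlow H t) y') (linPart (hamField H) z) +
        inner ℂ (hamField H z + antiPart (hamFlow H t) y') (antiPart (hamField H) z) := by
      rw [← inner_add_right, linPart_add_antiPart]
    rw [this]
    ring

/-- Bootstrapping on the differential equation of the root: its derivative is itself times a C¹
logarithmic derivative. -/
theorem contDiff_detRoot_inv : ContDiff ℝ 2 fun t : ℝ => (detRoot H t)⁻¹ := by
  have hdet : ContDiff ℝ 2 (fun t : ℝ => LinearMap.det (flowBlock H t)) := by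
    set b := (stdOrthonormalBasis ℂ V)
    have hdet : (fun t : ℝ => LinearMap.det (flowBlock H t)) = fun t : ℝ =>
        Matrix.det (LinearMap.toMatrix b.toBasis b.toBasis (flowBlock H t)) := by
      funext t; rw [LinearMap.det_toMatrix]
    rw [hdet]
    simp only [Matrix.det_apply]
    refine ContDiff.sum fun σ _ => ContDiff.const_smul _ (contDiff_prod fun i _ => ?_)
    have : (fun t : ℝ => LinearMap.toMatrix b.toBasis b.toBasis (flowBlock H t) (σ i) i) =
        fun t : ℝ => inner ℂ (b (σ i)) (linPart (hamFlow H t) (b i)) := by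
      funext t
      rw [LinearMap.toMatrix_apply, ← holBlock_apply]
      simp [b.repr_apply_apply, flowBlock]
    rw [this]
    exact contDiff_const.inner ℂ ((contDiff_linPart_hamFlow H).clm_apply contDiff_const)
  have hroot : ContDiff ℝ 2 (detRoot H) := by
    have hlog : ContDiff ℝ 1 fun t => (1 / 2 : ℂ) *
        (deriv (fun r : ℝ => LinearMap.det (flowBlock H r)) t / LinearMap.det (flowBlock H t)) := by
      simp only [div_eq_mul_inv]
      refine contDiff_const.mul (ContDiff.mul ?_ ((hdet.of_le (by norm_num)).inv
        fun t => det_flowBlock_ne_zero H t))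
      have h2 : ContDiff ℝ (1 + 1) (fun t : ℝ => LinearMap.det (flowBlock H t)) := by
        norm_num; exact hdet
      exact (contDiff_succ_iff_deriv.1 h2).2.2
    have hd : deriv (detRoot H) = fun t => detRoot H t * ((1 / 2 : ℂ) *
        (deriv (fun r : ℝ => LinearMap.det (flowBlock H r)) t / LinearMap.det (flowBlock H t))) :=
      funext fun t => (hasDerivAt_detRoot H t).deriv
    have hdiff : Differentiable ℝ (detRoot H) := fun t => (hasDerivAt_detRoot H t).differentiableAt
    have h1 : ContDiff ℝ 1 (detRoot H) := by
      rw [contDiff_one_iff_deriv, hd]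
      exact ⟨hdiff, hdiff.continuous.mul hlog.continuous⟩
    have h2 : ContDiff ℝ (1 + 1) (detRoot H) := by
      rw [contDiff_succ_iff_deriv, hd]
      exact ⟨hdiff, by simp, h1.mul hlog⟩
    norm_num at h2
    exact h2
  exact hroot.inv fun t => detRoot_ne_zero H t

end Flow

end BargmannFock

namespace BargmannFock

section Trace

/-! ### Smoothness of the Fourier transform -/

theorem contDiff_fourierHat (f : 𝓢(ℝ, ℂ)) : ContDiff ℝ 2 (fourierHat f) := by
  have h : fourierHat f = fun t : ℝ =>
      (2 * π : ℂ)⁻¹ * (FourierTransform.fourier f : 𝓢(ℝ, ℂ)) (t / (2 * π)) := by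
    funext t
    rw [fourierHat, SchwartzMap.fourier_coe, Real.fourier_real_eq_integral_exp_smul]
    congr 1
    refine integral_congr_ae (Eventually.of_forall fun x => ?_)
    simp only [smul_eq_mul]
    rw [mul_comm]
    congr 2
    have : (π : ℂ) ≠ 0 := by exact_mod_cast Real.pi_ne_zero
    push_cast
    field_simp
  rw [h]
  exact contDiff_const.mul (((FourierTransform.fourier f : 𝓢(ℝ, ℂ)).smooth 2).comp
    (contDiff_id.div_const _))

/-- The positive real factor leaves the principal root freely, and Re γ > 0 keeps γ off the cut, so
that log γ⁻¹ = -log γ. -/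
theorem pow_mul_cpow_gauss (m : ℕ) {k : ℝ} (hk : 0 < k) {γ : ℂ} (hγ : 0 < γ.re) :
    ((k : ℂ) / (2 * π)) ^ m * (2 * π / (k * γ)) ^ (1 / 2 : ℂ) =
      (((k / (2 * π)) ^ ((m : ℝ) - 1 / 2) : ℝ) : ℂ) * γ ^ (-(1 / 2) : ℂ) := by
  have hγ0 : γ ≠ 0 := by rintro rfl; simp at hγ
  have harg : γ.arg ≠ π := by
    have := (Complex.abs_arg_lt_pi_div_two_iff (z := γ)).2 (Or.inl hγ)
    have h2 := (abs_lt.1 this).2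
    intro h
    rw [h] at h2
    linarith [Real.pi_pos]
  set x : ℝ := k / (2 * π) with hx
  have hx0 : 0 < x := by positivity
  have e1 : (k : ℂ) / (2 * π) = (x : ℂ) := by rw [hx]; push_cast; rfl
  have e2 : (2 * π / (k * γ) : ℂ) = ((x⁻¹ : ℝ) : ℂ) * γ⁻¹ := by
    have : (π : ℂ) ≠ 0 := by exact_mod_cast Real.pi_ne_zero
    have : (k : ℂ) ≠ 0 := by exact_mod_cast hk.ne'
    rw [hx]; push_cast; field_simp
  have e3 : (((x⁻¹ : ℝ) : ℂ) * γ⁻¹) ^ (1 / 2 : ℂ) =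
      ((x ^ (-(1 / 2) : ℝ) : ℝ) : ℂ) * γ ^ (-(1 / 2) : ℂ) := by
    rw [Complex.cpow_def_of_ne_zero (mul_ne_zero (by exact_mod_cast (inv_pos.2 hx0).ne')
      (inv_ne_zero hγ0)), Complex.log_ofReal_mul (inv_pos.2 hx0) (inv_ne_zero hγ0),
      Complex.log_inv _ harg, Complex.cpow_def_of_ne_zero hγ0, Real.rpow_def_of_pos hx0,
      Real.log_inv, Complex.ofReal_exp, ← Complex.exp_add]
    congr 1
    push_cast
    ring
  rw [e1, e2, e3, ← mul_assoc, ← Complex.ofReal_pow, ← Complex.ofReal_mul, ← Real.rpow_natCast,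
    ← Real.rpow_add hx0, sub_eq_add_neg]

variable {V : Type*} [NormedAddCommGroup V] [InnerProductSpace ℂ V] [FiniteDimensional ℂ V]
  {H : QuadraticForm ℝ V}

/-! ### Periods -/

theorem hamFlow_neg_of_fixed {t : ℝ} {z : V} (h : hamFlow H t z = z) : hamFlow H (-t) z = z := by
  conv_lhs => rw [← h]
  rw [← hamFlow_add, neg_add_cancel, hamFlow_zero]

theorem hamFlow_natCast_mul_of_fixed {t : ℝ} {z : V} (h : hamFlow H t z = z) (n : ℕ) :
    hamFlow H (n * t) z = z := by
  induction n with
  | zero => simp [hamFlow_zero]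
  | succ n ih => rw [Nat.cast_succ, add_mul, one_mul, hamFlow_add, h, ih]

theorem hamFlow_intCast_mul_of_fixed {t : ℝ} {z : V} (h : hamFlow H t z = z) (n : ℤ) :
    hamFlow H (n * t) z = z := by
  rcases Int.eq_nat_or_neg n with ⟨k, rfl | rfl⟩
  · simpa using hamFlow_natCast_mul_of_fixed h k
  · have := hamFlow_neg_of_fixed (hamFlow_natCast_mul_of_fixed h k)
    simpa using this

/-- Otherwise |s| ≤ T/2 would be a shorter period. Hence a closed cell of length T centred at nT
contains no other return time. -/
theorem IsMinimalPeriod.hamFlow_add_ne {z : V} {T : ℝ} (hT : IsMinimalPeriod H z T) (n : ℤ)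
    {s : ℝ} (hs : |s| ≤ T / 2) (hs0 : s ≠ 0) : hamFlow H (n * T + s) z ≠ z := by
  intro h
  obtain ⟨⟨hTpos, hTz⟩, hmin⟩ := hT
  rw [add_comm, hamFlow_add, hamFlow_intCast_mul_of_fixed hTz] at h
  have habs : hamFlow H |s| z = z := by
    rcases abs_choice s with h' | h' <;> rw [h']
    · exact h
    · exact hamFlow_neg_of_fixed h
  have := hmin ⟨abs_pos.2 hs0, habs⟩
  linarith

/-- At an equilibrium T/2 would also be a period. -/
theorem IsMinimalPeriod.hamField_ne_zero {z : V} {T : ℝ} (hT : IsMinimalPeriod H z T) :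
    hamField H z ≠ 0 := by
  intro h0
  have hd : ∀ t, HasDerivAt (fun s => hamFlow H s z) 0 t := by
    intro t
    have h := hasDerivAt_hamFlow H z t
    rwa [hamField_hamFlow, h0, map_zero] at h
  have hconst := is_const_of_deriv_eq_zero (fun t => (hd t).differentiableAt) fun t => (hd t).deriv
  obtain ⟨⟨hTpos, -⟩, hmin⟩ := hT
  have : hamFlow H (T / 2) z = z := by rw [hconst (T / 2) 0, hamFlow_zero]
  have := hmin ⟨by linarith, this⟩
  linarith

theorem linPart_ringInverse_flowBlock (t : ℝ) (α : V) :
    linPart (hamFlow H t) (Ring.inverse (flowBlock H t) α) = α := by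
  have hu : IsUnit (flowBlock H t) :=
    (LinearMap.isUnit_iff_isUnit_det _).2 (det_flowBlock_ne_zero H t).isUnit
  rw [← holBlock_apply]
  change (flowBlock H t * Ring.inverse (flowBlock H t)) α = α
  rw [Ring.mul_inverse_cancel _ hu]
  rfl

/-- The contribution of one period cell. -/
theorem exists_cell_bound {z : V} {T : ℝ} (hT : IsMinimalPeriod H z T) {a : ℝ → ℂ}
    (ha : ContDiff ℝ 2 a) (n : ℤ) :
    0 < (inner ℂ (hamField H z)
        (Ring.inverse (flowBlock H (n * T)) (hamField H z))).re ∧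
    ∃ C, ∀ k : ℕ, 0 < k →
      ‖(∫ t in (n * T - T / 2)..(n * T + T / 2), a t *
            Complex.exp (k * (graphPhase (hamFlow H t) z - Complex.I * t * H z))) -
          a (n * T) * Complex.exp (-(Complex.I * k * holonomyAngle H z (n * T))) *
            (2 * π / (k * inner ℂ (hamField H z)
              (Ring.inverse (flowBlock H (n * T)) (hamField H z)))) ^ (1 / 2 : ℂ)‖
        ≤ C * (k : ℝ) ^ (-(3 / 2) : ℝ) := by
  have hTpos : 0 < T := hT.1.1
  have hz : hamFlow H (n * T) z = z := hamFlow_intCast_mul_of_fixed hT.1.2 n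
  set v := Ring.inverse (flowBlock H (n * T)) (hamField H z) with hv
  have hPv : linPart (hamFlow H (n * T)) v = hamField H z := linPart_ringInverse_flowBlock _ _
  have hS := isSymplectic_hamFlow H (n * T)
  have hfix : hamFlow H (n * T) (hamField H z) = hamField H z := by rw [← hamField_hamFlow, hz]
  have hpos := (hS.re_inner_pos hfix hT.hamField_ne_zero hPv).2
  refine ⟨hpos, ?_⟩
  obtain ⟨hd1, hd2⟩ := hasDerivAt_deriv_graphPhase H hz hPv
  set φ : ℝ → ℂ := fun t => graphPhase (hamFlow H t) z with hφ
  have hφc : ContDiff ℝ 4 φ := contDiff_graphPhase H z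
  have hφd : Differentiable ℝ φ := hφc.differentiable (by norm_num)
  -- The subtracted term is imaginary and linear: it cancels φ' = iH(z) at the return time without
  -- changing the real part.
  set ψ : ℝ → ℂ := fun s => φ (n * T + s) - Complex.I * ((n * T + s : ℝ) : ℂ) * H z with hψ
  have hlin : ∀ s : ℝ, HasDerivAt (fun s : ℝ => Complex.I * ((n * T + s : ℝ) : ℂ) * H z)
      (Complex.I * H z) s := by
    intro s
    have h := (((hasDerivAt_id s).const_add (n * T)).ofReal_comp.const_mul Complex.I).mul_const
      (H z : ℂ)
    simpa using h
  have hψ' : deriv ψ = fun s => deriv φ (n * T + s) - Complex.I * H z := by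
    funext s
    exact (((hφd _).hasDerivAt.comp_const_add (n * T) s).sub (hlin s)).deriv
  have hψc : ContDiff ℝ 4 ψ := by
    refine (hφc.comp (contDiff_const.add contDiff_id)).sub ?_
    exact (contDiff_const.mul (Complex.ofRealCLM.contDiff.comp
      (contDiff_const.add contDiff_id))).mul contDiff_const
  have h1 : deriv ψ 0 = 0 := by
    rw [hψ']
    simp only [add_zero]
    rw [hd1, sub_self]
  have h2 : deriv (deriv ψ) 0 = -inner ℂ (hamField H z) v := by
    rw [hψ']
    have h3 : HasDerivAt (deriv φ) (-inner ℂ (hamField H z) v) (n * T + 0) := by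
      rw [add_zero]; exact hd2
    exact ((h3.comp_const_add (n * T) 0).sub_const _).deriv
  have hψre : ∀ s, (ψ s).re = (graphPhase (hamFlow H (n * T + s)) z).re := by
    intro s
    simp only [hψ, hφ, Complex.sub_re]
    rw [mul_assoc, ← Complex.ofReal_mul, Complex.I_mul_re, Complex.ofReal_im, neg_zero, sub_zero]
  have h0 : ψ 0 = -(Complex.I * (n * T : ℝ) * H z) := by
    simp only [hψ, hφ, add_zero, hS.graphPhase_eq_zero hz, zero_sub]
  obtain ⟨C, hC⟩ := laplace_expansion (δ := T / 2) (a := fun s => a (n * T + s)) (ψ := ψ)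
    (by linarith) (ha.comp (contDiff_const.add contDiff_id)) hψc
    (by rw [hψre, add_zero, hS.graphPhase_eq_zero hz, Complex.zero_re]) h1 h2 hpos
    (fun s hs hs0 => by
      rw [hψre]
      exact (isSymplectic_hamFlow H _).re_graphPhase_neg (hT.hamFlow_add_ne n hs hs0))
  refine ⟨C, fun k hk => ?_⟩
  have h3 := hC k hk
  have hshift := intervalIntegral.integral_comp_add_left (a := -(T / 2)) (b := T / 2)
    (fun t : ℝ => a t * Complex.exp (k * (φ t - Complex.I * t * H z))) (n * T)
  rw [← sub_eq_add_neg] at hshift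
  rw [← hshift, holonomyAngle_eq]
  rw [h0] at h3
  convert h3 using 6
  · rw [add_zero]
  · push_cast; ring

end Trace

end BargmannFock

/-! ### Summation over the period cells -/

open BargmannFock in
theorem norm_trace_sub_le {V : Type*} [NormedAddCommGroup V] [InnerProductSpace ℂ V]
    [FiniteDimensional ℂ V] [MeasurableSpace V] [BorelSpace V]
    (H : QuadraticForm ℝ V) (z : V) (T : ℝ) (hT : IsMinimalPeriod H z T)
    (f : 𝓢(ℝ, ℂ)) (hf : HasCompactSupport (fourierHat f)) :
    ∃ C, ∀ k : ℕ, 0 < k →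
      ‖(∫ t : ℝ, fourierHat f t * propagator H k t z z *
          Complex.exp (-(Complex.I * t * H z * k)))
        - ((((k : ℝ) / (2 * π)) ^ ((Module.finrank ℂ V : ℝ) - 1 / 2) : ℝ) : ℂ) *
          ∑' n : ℤ, fourierHat f (n * T) *
            Complex.exp (-(Complex.I * k * holonomyAngle H z (n * T))) *
            (inner ℂ (hamField H z)
              (Ring.inverse (flowBlock H (n * T))
                (hamField H z))) ^ (-(1 / 2) : ℂ) *
            (detRoot H (n * T))⁻¹‖ ≤ C * (k : ℝ) ^ ((Module.finrank ℂ V : ℝ) - 3 / 2) := by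
  set m := Module.finrank ℂ V with hm
  have hTpos : 0 < T := hT.1.1
  set a : ℝ → ℂ := fun t => fourierHat f t * (detRoot H t)⁻¹ with ha
  have hac : ContDiff ℝ 2 a := (contDiff_fourierHat f).mul (contDiff_detRoot_inv H)
  choose hpos C hC using exists_cell_bound hT hac
  obtain ⟨R, hRpos, hR⟩ := hf.exists_pos_le_norm
  -- With NT ≥ R the 2N + 1 cells centred at nT, |n| ≤ N, cover the support of f̂.
  obtain ⟨N, hN⟩ := exists_nat_ge (R / T)
  rw [div_le_iff₀ hTpos] at hN
  refine ⟨(2 * π)⁻¹ ^ m * ∑ j ∈ Finset.range (2 * N + 1), C ((j : ℤ) - N), fun k hk => ?_⟩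
  have hk' : (0 : ℝ) < k := by exact_mod_cast hk
  set g : ℝ → ℂ := fun t => a t *
    Complex.exp (k * (graphPhase (hamFlow H t) z - Complex.I * t * H z)) with hg
  have hgc : Continuous g := by
    have h1 := hac.continuous
    have h2 := (contDiff_graphPhase H (n := 0) z).continuous
    simp only [hg]
    fun_prop
  have hint : (∫ t : ℝ, fourierHat f t * propagator H k t z z *
      Complex.exp (-(Complex.I * t * H z * k))) = ((k : ℂ) / (2 * π)) ^ m * ∫ t, g t := by
    rw [← integral_const_mul]
    refine integral_congr_ae (Eventually.of_forall fun t => ?_)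
    simp only [hg, ha]
    rw [propagator_self H hk,
      show (k : ℂ) * (graphPhase (hamFlow H t) z - Complex.I * t * H z) =
        k * graphPhase (hamFlow H t) z + -(Complex.I * t * H z * k) by ring, Complex.exp_add]
    ring
  set c : ℕ → ℝ := fun j => ((j : ℝ) - N - 1 / 2) * T with hc
  have hcells : ∫ t, g t = ∑ j ∈ Finset.range (2 * N + 1),
      ∫ t in ((((j : ℤ) - N : ℤ) : ℝ) * T - T / 2)..((((j : ℤ) - N : ℤ) : ℝ) * T + T / 2), g t := by
    have h1 := intervalIntegral.sum_integral_adjacent_intervals (f := g) (a := c)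
      (n := 2 * N + 1) (μ := volume) fun j _ => hgc.intervalIntegrable _ _
    have h2 : ∫ t in (c 0)..(c (2 * N + 1)), g t = ∫ t, g t := by
      refine intervalIntegral.integral_eq_integral_of_support_subset fun t ht => ?_
      by_contra hcon
      apply ht
      have : R ≤ ‖t‖ := by
        by_contra hlt
        apply hcon
        rw [not_le, Real.norm_eq_abs, abs_lt] at hlt
        simp only [hc, Set.mem_Ioc]
        push_cast
        constructor <;> nlinarith [hlt.1, hlt.2]
      simp only [hg, ha, hR t this, zero_mul]
    rw [← h2, ← h1]
    refine Finset.sum_congr rfl fun j _ => ?_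
    simp only [hc]
    push_cast
    congr 1 <;> ring
  have hsum : (∑' n : ℤ, fourierHat f (n * T) *
      Complex.exp (-(Complex.I * k * holonomyAngle H z (n * T))) *
      (inner ℂ (hamField H z) (Ring.inverse (flowBlock H (n * T)) (hamField H z))) ^
        (-(1 / 2) : ℂ) * (detRoot H (n * T))⁻¹) =
      ∑ j ∈ Finset.range (2 * N + 1), fourierHat f (((j : ℤ) - N : ℤ) * T) *
        Complex.exp (-(Complex.I * k * holonomyAngle H z (((j : ℤ) - N : ℤ) * T))) *
        (inner ℂ (hamField H z)
          (Ring.inverse (flowBlock H (((j : ℤ) - N : ℤ) * T)) (hamField H z))) ^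
        (-(1 / 2) : ℂ) * (detRoot H (((j : ℤ) - N : ℤ) * T))⁻¹ := by
    -- For |n| > N the coefficient f̂(nT) vanishes, so the series is a finite sum indexed like the
    -- cells.
    rw [tsum_eq_sum (s := (Finset.range (2 * N + 1)).image fun j : ℕ => (j : ℤ) - N),
      Finset.sum_image]
    · intro i _ j _ hij
      simpa using hij
    · intro n hn
      have hnN : (N : ℤ) ≤ |n| := by
        by_contra hlt
        apply hn
        rw [not_le, abs_lt] at hlt
        refine Finset.mem_image.2 ⟨(n + N).toNat, Finset.mem_range.2 (by omega), by omega⟩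
      have : R ≤ ‖(n : ℝ) * T‖ := by
        rw [Real.norm_eq_abs, abs_mul, abs_of_pos hTpos]
        refine hN.trans ?_
        have : (N : ℝ) ≤ |(n : ℝ)| := by exact_mod_cast hnN
        gcongr
      rw [hR _ this]
      simp only [zero_mul]
  rw [hint, hcells, hsum, Finset.mul_sum, Finset.mul_sum, ← Finset.sum_sub_distrib]
  refine (norm_sum_le _ _).trans ?_
  rw [Finset.mul_sum, Finset.sum_mul]
  refine Finset.sum_le_sum fun j _ => ?_
  set n : ℤ := (j : ℤ) - N with hn
  have hcell := hC n k hk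
  set γ := inner ℂ (hamField H z) (Ring.inverse (flowBlock H (n * T)) (hamField H z)) with hγ
  have hgauss := pow_mul_cpow_gauss m hk' (hpos n)
  rw [Complex.ofReal_natCast] at hgauss
  have hrw : ((((k : ℝ) / (2 * π)) ^ ((m : ℝ) - 1 / 2) : ℝ) : ℂ) *
      (fourierHat f (n * T) * Complex.exp (-(Complex.I * k * holonomyAngle H z (n * T))) *
        γ ^ (-(1 / 2) : ℂ) * (detRoot H (n * T))⁻¹) = ((k : ℂ) / (2 * π)) ^ m *
      (a (n * T) * Complex.exp (-(Complex.I * k * holonomyAngle H z (n * T))) *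
        (2 * π / (k * γ)) ^ (1 / 2 : ℂ)) := by
    simp only [ha]
    linear_combination (-(fourierHat f (n * T) *
      Complex.exp (-(Complex.I * k * holonomyAngle H z (n * T))) * (detRoot H (n * T))⁻¹)) * hgauss
  rw [hrw, ← mul_sub, norm_mul]
  have hnorm : ‖((k : ℂ) / (2 * π)) ^ m‖ = (2 * π)⁻¹ ^ m * (k : ℝ) ^ m := by
    rw [norm_pow, norm_div, norm_mul, Complex.norm_natCast, Complex.norm_real, Complex.norm_ofNat,
      Real.norm_eq_abs, abs_of_pos Real.pi_pos, div_eq_inv_mul, mul_pow]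
  have hpow : (k : ℝ) ^ ((m : ℝ) - 3 / 2) = (k : ℝ) ^ m * (k : ℝ) ^ (-(3 / 2) : ℝ) := by
    rw [sub_eq_add_neg, Real.rpow_add hk', Real.rpow_natCast]
  rw [hnorm, hpow]
  calc _ ≤ (2 * π)⁻¹ ^ m * (k : ℝ) ^ m * (C n * (k : ℝ) ^ (-(3 / 2) : ℝ)) := by gcongr
    _ = _ := by ring

theorem mainTheorem4 {V : Type*} [NormedAddCommGroup V] [InnerProductSpace ℂ V]
    [FiniteDimensional ℂ V] [MeasurableSpace V] [BorelSpace V]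
    (H : QuadraticForm ℝ V) (E : ℝ)
    (hcompact : ∀ c : ℝ, IsCompact {w : V | H w = c})
    (hnondeg : BargmannFock.NondegenerateOrbits H E)
    (z : V) (hz : H z = E) (T : ℝ) (hT : BargmannFock.IsMinimalPeriod H z T)
    (f : 𝓢(ℝ, ℂ)) (hf : HasCompactSupport (BargmannFock.fourierHat f)) :
    (fun k : ℕ =>
      (∫ t : ℝ, BargmannFock.fourierHat f t * BargmannFock.propagator H k t z z *
          Complex.exp (-(Complex.I * t * E * k)))
        - ((((k : ℝ) / (2 * π)) ^ ((Module.finrank ℂ V : ℝ) - 1 / 2) : ℝ) : ℂ) *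
          ∑' n : ℤ, BargmannFock.fourierHat f (n * T) *
            Complex.exp (-(Complex.I * k * BargmannFock.holonomyAngle H z (n * T))) *
            (inner ℂ (BargmannFock.hamField H z)
              (Ring.inverse (BargmannFock.flowBlock H (n * T))
                (BargmannFock.hamField H z))) ^ (-(1 / 2) : ℂ) *
            (BargmannFock.detRoot H (n * T))⁻¹)
      =O[atTop] (fun k : ℕ => (k : ℝ) ^ ((Module.finrank ℂ V : ℝ) - 3 / 2)) := by
  obtain ⟨C, hC⟩ := norm_trace_sub_le H z T hT f hf
  refine IsBigO.of_bound C (eventually_atTop.2 ⟨1, fun k hk => ?_⟩)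
  have h := hC k hk
  rw [hz] at h
  rwa [Real.norm_of_nonneg (by positivity)]
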